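/- Let $X$ be a smooth algebraic variety over $\mathbb{C}$ (a smooth separated scheme of finite type over $\mathbb{C}$). Let $\overline{\mathbf V}(X)$ be the category of bounded complexes $\overline E$ of algebraic vector bundles on $X$, each of whose terms is equipped with a smooth hermitian metric on the associated analytic bundle; morphisms are morphisms of complexes. For a morphism $f\colon \overline E\to\overline F$, the hermitian cone $\overline{\operatorname{cone}}(f)$ is the complex with terms $E^{n+1}\oplus F^{n}$ and differential $(x,y)\mapsto(-dx,f(x)+dy)$, with the orthogonal sum metric; $\overline E[1]$ is the complex with terms $E^{n+1}$ and differential $-d$, with the same metrics; an isometry is an isomorphism of complexes preserving the metrics in every degree. A short exact sequence of hermitian vector bundles is orthogonally split if it is isometric to $0\to\overline A\to\overline A\oplus\overline C\to\overline C\to 0$ with the orthogonal sum metric. A complex $\overline E$ is orthogonally split if there are hermitian vector bundles $\overline Z^{n}$ and orthogonally split short exact sequences $0\to \overline Z^{n}\to\overline E^{n}\to\overline Z^{n+1}\to0$ such that the differential of $E$ is the composition $E^{n}\to Z^{n+1}\to E^{n+1}$. Let - $\mathscr M_0$ be the class of complexes that are orthogonally split, or isometric to $\overline F\oplus\overline F[1]$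 (orthogonal direct sum) for some acyclic $\overline F$ in $\overline{\mathbf V}(X)$; - $\mathscr M$ (the meager complexes) be the smallest class that contains $\mathscr M_0$ and is such that, for every morphism $f\colon\overline E\to\overline F$ in $\overline{\mathbf V}(X)$, if two of $\overline E$, $\overline F$, $\overline{\operatorname{cone}}(f)$ belong to the class, then so does the third; - $\mathscr M_F$ be the class of complexes $\overline E$ that admit a finite decreasing filtration $\operatorname{Fil}^{\bullet}$ by subcomplexes such that, for all $p,n\in\mathbb Z$, the sequence $0\to\operatorname{Fil}^{p+1}\overline E^{n}\to\operatorname{Fil}^{p}\overline E^{n}\to\operatorname{Gr}^{p}\overline E^{n}\to0$, with the induced metrics, is an orthogonally split short exact sequence of vector bundles, and all the complexes $\operatorname{Gr}^{p}\overline E$ belong to $\mathscr M_0$; - $\mathscr M_S$ be the class of complexes $\overline E$ for which there is a morphism $f\colon\overline E\to\overline F$ in $\overline{\mathbf V}(X)$ with both $\overline F$ and $\overline{\operatorname{cone}}(f)$ in $\mathscr M_F$. Then $\mathscr M=\mathscr M_S$. -/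

import Mathlib

open CategoryTheory Limits AlgebraicGeometry
open scoped ContDiff

noncomputable section

namespace HermitianComplexes

/-- The base scheme `Spec ℂ`. -/
abbrev SpecC : Scheme.{0} := Spec (CommRingCat.of ℂ)

/-! ### Complex points, regular functions and smooth functions -/

section Points

variable (X : Scheme.{0}) [X.Over SpecC]

/-- The complex points `X(ℂ)`: sections of the structure morphism `X ⟶ Spec ℂ`. -/
structure CPoint where
  hom : SpecC ⟶ X
  isSection : hom ≫ (X ↘ SpecC) = 𝟙 SpecC

variable {X}

/-- The complex point `x` lies in the Zariski open `U`. -/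
def CPoint.IsIn (x : CPoint X) (U : X.Opens) : Prop := ⊤ ≤ x.hom ⁻¹ᵁ U

lemma CPoint.IsIn.inf {x : CPoint X} {U V : X.Opens} (hU : x.IsIn U) (hV : x.IsIn V) :
    x.IsIn (U ⊓ V) := fun _ hy => ⟨hU hy, hV hy⟩

lemma CPoint.IsIn.mono {x : CPoint X} {U V : X.Opens} (hU : x.IsIn U) (h : U ≤ V) :
    x.IsIn V := fun _ hy => h (hU hy)

/-- The value `f(x) ∈ ℂ` of a regular function `f ∈ Γ(X, U)` at a complex point of `U`. -/
def CPoint.value (x : CPoint X) {U : X.Opens} (hx : x.IsIn U) (f : Γ(X, U)) : ℂ :=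
  (Scheme.ΓSpecIso (CommRingCat.of ℂ)).hom (x.hom.appLE U ⊤ hx f)

lemma CPoint.value_map (x : CPoint X) {U V : X.Opens} (i : V ⟶ U) (hx : x.IsIn V)
    (f : Γ(X, U)) :
    x.value hx (X.presheaf.map i.op f) = x.value (hx.mono (leOfHom i)) f := by
  have := x.hom.map_appLE (V := ⊤) hx i.op
  exact congrArg (fun g => (Scheme.ΓSpecIso (CommRingCat.of ℂ)).hom (g f)) this

/-- A complex valued function `φ` on `U(ℂ)` is smooth (for the `C^∞` structure of the analytic
space attached to `X`) if locally on `U(ℂ)` it is a `C^∞` function, in the real sense, of finitely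
many regular functions. The sets `{x ∈ V(ℂ) | (f₁(x), …, fₙ(x)) ∈ W}` with `V` Zariski open and `W`
open in `ℂⁿ` are a basis of the analytic topology of `X(ℂ)`. When `X` is smooth over `ℂ`, generators
`f₁, …, fₙ` of the algebra of regular functions of an affine open `V` embed the complex manifold
`V(ℂ)` as a closed submanifold of `ℂⁿ`, so these are the usual `C^∞` functions. -/
def IsSmoothFun {U : X.Opens} (φ : ∀ x : CPoint X, x.IsIn U → ℂ) : Prop :=
  ∀ (x₀ : CPoint X), x₀.IsIn U →
    ∃ (V : X.Opens) (hVU : V ≤ U) (hx₀ : x₀.IsIn V) (n : ℕ) (f : Fin n → Γ(X, V))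
      (W : Set (Fin n → ℂ)) (g : (Fin n → ℂ) → ℂ),
      IsOpen W ∧ (fun k => x₀.value hx₀ (f k)) ∈ W ∧ ContDiffOn ℝ ∞ g W ∧
        ∀ (x : CPoint X) (hx : x.IsIn V), (fun k => x.value hx (f k)) ∈ W →
          φ x (hx.mono hVU) = g (fun k => x.value hx (f k))

lemma IsSmoothFun.add {U : X.Opens} {φ ψ : ∀ x : CPoint X, x.IsIn U → ℂ}
    (hφ : IsSmoothFun φ) (hψ : IsSmoothFun ψ) : IsSmoothFun (fun x hx => φ x hx + ψ x hx) := by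
  intro x₀ hx₀
  obtain ⟨V₁, h₁, hx₁, n₁, f₁, W₁, g₁, hW₁, hxW₁, hg₁, e₁⟩ := hφ x₀ hx₀
  obtain ⟨V₂, h₂, hx₂, n₂, f₂, W₂, g₂, hW₂, hxW₂, hg₂, e₂⟩ := hψ x₀ hx₀
  let p₁ : (Fin (n₁ + n₂) → ℂ) → (Fin n₁ → ℂ) := fun z k => z (Fin.castAdd n₂ k)
  let p₂ : (Fin (n₁ + n₂) → ℂ) → (Fin n₂ → ℂ) := fun z k => z (Fin.natAdd n₁ k)
  have c₁ : ContDiff ℝ ∞ p₁ := by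
    rw [contDiff_pi]; intro k; exact contDiff_apply ℝ ℂ _
  have c₂ : ContDiff ℝ ∞ p₂ := by
    rw [contDiff_pi]; intro k; exact contDiff_apply ℝ ℂ _
  let i₁ : V₁ ⊓ V₂ ⟶ V₁ := homOfLE inf_le_left
  let i₂ : V₁ ⊓ V₂ ⟶ V₂ := homOfLE inf_le_right
  let f : Fin (n₁ + n₂) → Γ(X, V₁ ⊓ V₂) :=
    Fin.append (fun k => X.presheaf.map i₁.op (f₁ k)) (fun k => X.presheaf.map i₂.op (f₂ k))
  have q₁ : ∀ (x : CPoint X) (hx : x.IsIn (V₁ ⊓ V₂)), p₁ (fun k => x.value hx (f k)) =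
      fun k => x.value (hx.mono inf_le_left) (f₁ k) := by
    intro x hx; funext k
    simp only [p₁, f, Fin.append_left]
    exact x.value_map i₁ hx _
  have q₂ : ∀ (x : CPoint X) (hx : x.IsIn (V₁ ⊓ V₂)), p₂ (fun k => x.value hx (f k)) =
      fun k => x.value (hx.mono inf_le_right) (f₂ k) := by
    intro x hx; funext k
    simp only [p₂, f, Fin.append_right]
    exact x.value_map i₂ hx _
  refine ⟨V₁ ⊓ V₂, inf_le_left.trans h₁, hx₁.inf hx₂, n₁ + n₂, f, p₁ ⁻¹' W₁ ∩ p₂ ⁻¹' W₂,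
    fun z => g₁ (p₁ z) + g₂ (p₂ z), ?_, ?_, ?_, ?_⟩
  · exact (hW₁.preimage c₁.continuous).inter (hW₂.preimage c₂.continuous)
  · refine ⟨?_, ?_⟩
    · rw [Set.mem_preimage, q₁]; exact hxW₁
    · rw [Set.mem_preimage, q₂]; exact hxW₂
  · exact (hg₁.comp c₁.contDiffOn (fun z hz => hz.1)).add
      (hg₂.comp c₂.contDiffOn (fun z hz => hz.2))
  · intro x hx hxW
    have m₁ := hxW.1
    have m₂ := hxW.2
    rw [Set.mem_preimage, q₁] at m₁
    rw [Set.mem_preimage, q₂] at m₂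
    refine (congrArg₂ (· + ·) (e₁ x (hx.mono inf_le_left) m₁)
      (e₂ x (hx.mono inf_le_right) m₂)).trans ?_
    rw [← q₁ x hx, ← q₂ x hx]

end Points

/-! ### Algebraic vector bundles and their fibres -/

section Bundles

variable {X : Scheme.{0}}

/-- An algebraic vector bundle: a sheaf of `𝒪_X`-modules that is locally isomorphic to a free
module of finite rank. -/
def IsVectorBundle (M : X.Modules) : Prop :=
  ∀ x : X, ∃ U : X.Opens, x ∈ U ∧ ∃ I : Type, Finite I ∧
    Nonempty (M.restrict U.ι ≅ SheafOfModules.free (R := U.toScheme.ringCatSheaf) I)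

lemma IsVectorBundle.of_iso {M N : X.Modules} (e : M ≅ N) (hM : IsVectorBundle M) :
    IsVectorBundle N := by
  intro x
  obtain ⟨U, hx, I, hI, ⟨f⟩⟩ := hM x
  exact ⟨U, hx, I, hI, ⟨((Scheme.Modules.restrictFunctor U.ι).mapIso e).symm ≪≫ f⟩⟩

lemma exists_restrict_iso {M : X.Modules} {U V : X.Opens} (h : V ≤ U) {I : Type}
    (e : M.restrict U.ι ≅ SheafOfModules.free (R := U.toScheme.ringCatSheaf) I) :
    Nonempty (M.restrict V.ι ≅ SheafOfModules.free (R := V.toScheme.ringCatSheaf) I) := by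
  have e₁ : M.restrict V.ι ≅ (M.restrict U.ι).restrict (X.homOfLE h) :=
    (Scheme.Modules.restrictFunctorCongr (X.homOfLE_ι h).symm).app M ≪≫
      (Scheme.Modules.restrictFunctorComp (X.homOfLE h) U.ι).app M
  let F : SheafOfModules U.toScheme.ringCatSheaf ⥤ SheafOfModules V.toScheme.ringCatSheaf :=
    Scheme.Modules.restrictFunctor (X.homOfLE h)
  have : PreservesColimitsOfSize.{0, 0} (Scheme.Modules.restrictFunctor (X.homOfLE h)) :=
    inferInstance
  have hF : PreservesColimitsOfSize.{0, 0} F := this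
  let e₂ : F.obj (SheafOfModules.free I) ≅ SheafOfModules.free I :=
    (SheafOfModules.mapFreeIso F I (Scheme.Modules.restrictUnitIso (X.homOfLE h)).symm).symm
  exact ⟨e₁ ≪≫ (Scheme.Modules.restrictFunctor (X.homOfLE h)).mapIso e ≪≫ e₂⟩

lemma IsVectorBundle.biprod {M N : X.Modules} (hM : IsVectorBundle M) (hN : IsVectorBundle N) :
    IsVectorBundle (M ⊞ N) := by
  intro x
  obtain ⟨U, hxU, I, hI, ⟨e⟩⟩ := hM x
  obtain ⟨V, hxV, J, hJ, ⟨f⟩⟩ := hN x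
  obtain ⟨e'⟩ := exists_restrict_iso (V := U ⊓ V) inf_le_left e
  obtain ⟨f'⟩ := exists_restrict_iso (V := U ⊓ V) inf_le_right f
  refine ⟨U ⊓ V, ⟨hxU, hxV⟩, I ⊕ J, inferInstance, ⟨?_⟩⟩
  let F := Scheme.Modules.restrictFunctor (U ⊓ V).ι
  have : PreservesColimitsOfSize.{0, 0} F := inferInstance
  have : PreservesBinaryBiproducts F := preservesBinaryBiproducts_of_preservesBinaryCoproducts F
  let c : (F.obj M ⊞ F.obj N) ≅ F.obj M ⨿ F.obj N := biprod.isoCoprod _ _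
  exact F.mapBiprod M N ≪≫ c ≪≫ coprod.mapIso e' f' ≪≫
    SheafOfModules.freeSumIso I J

variable [X.Over SpecC]

/-- The fibre `M(x) = x^* M` of a sheaf of modules at a complex point, a complex vector space. -/
def Fiber (x : CPoint X) (M : X.Modules) : Type :=
  Γ((Scheme.Modules.pullback x.hom).obj M, (⊤ : SpecC.Opens))

instance (x : CPoint X) (M : X.Modules) : AddCommGroup (Fiber x M) :=
  inferInstanceAs (AddCommGroup Γ((Scheme.Modules.pullback x.hom).obj M, (⊤ : SpecC.Opens)))

instance (x : CPoint X) (M : X.Modules) : Module ℂ (Fiber x M) :=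
  Module.compHom (R := Γ(SpecC, (⊤ : SpecC.Opens)))
    Γ((Scheme.Modules.pullback x.hom).obj M, (⊤ : SpecC.Opens))
    (Scheme.ΓSpecIso (CommRingCat.of ℂ)).inv.hom

/-- The linear map induced on fibres by a morphism of sheaves of modules. -/
def fiberMap (x : CPoint X) {M N : X.Modules} (φ : M ⟶ N) : Fiber x M →ₗ[ℂ] Fiber x N where
  toFun u := ((Scheme.Modules.pullback x.hom).map φ).app ⊤ u
  map_add' u v := map_add (((Scheme.Modules.pullback x.hom).map φ).app ⊤).hom u v
  map_smul' c u := ((Scheme.Modules.pullback x.hom).map φ).app_smul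
    ((Scheme.ΓSpecIso (CommRingCat.of ℂ)).inv.hom c) u

lemma fiberMap_id (x : CPoint X) {M : X.Modules} (u : Fiber x M) : fiberMap x (𝟙 M) u = u := by
  simp only [fiberMap, LinearMap.coe_mk, CategoryTheory.Functor.map_id]
  rfl

lemma fiberMap_comp (x : CPoint X) {M N P : X.Modules} (φ : M ⟶ N) (ψ : N ⟶ P)
    (u : Fiber x M) : fiberMap x (φ ≫ ψ) u = fiberMap x ψ (fiberMap x φ u) := by
  simp only [fiberMap, LinearMap.coe_mk, CategoryTheory.Functor.map_comp]
  rfl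

lemma fiberMap_add (x : CPoint X) {M N : X.Modules} (φ ψ : M ⟶ N)
    (u : Fiber x M) : fiberMap x (φ + ψ) u = fiberMap x φ u + fiberMap x ψ u := by
  simp only [fiberMap, LinearMap.coe_mk, CategoryTheory.Functor.map_add]
  rfl

/-- The value `s(x) ∈ M(x)` of a section `s ∈ Γ(M, U)` at a complex point of `U`. -/
def sectionValue (x : CPoint X) {M : X.Modules} {U : X.Opens} (hx : x.IsIn U) (s : Γ(M, U)) :
    Fiber x M :=
  ((Scheme.Modules.pullback x.hom).obj M).presheaf.map (homOfLE hx).op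
    (((Scheme.Modules.pullbackPushforwardAdjunction x.hom).unit.app M).app U s)

lemma fiberMap_sectionValue (x : CPoint X) {M N : X.Modules} (φ : M ⟶ N) {U : X.Opens}
    (hx : x.IsIn U) (s : Γ(M, U)) :
    fiberMap x φ (sectionValue x hx s) = sectionValue x hx (φ.app U s) := by
  let P := Scheme.Modules.pullback x.hom
  let η := (Scheme.Modules.pullbackPushforwardAdjunction x.hom).unit
  have h₁ : (η.app N).app U (φ.app U s) = (P.map φ).app (x.hom ⁻¹ᵁ U) ((η.app M).app U s) :=
    congrArg (fun g : M ⟶ (Scheme.Modules.pushforward x.hom).obj (P.obj N) =>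
      Scheme.Modules.Hom.app g U s) (η.naturality φ)
  have h₂ := ConcreteCategory.congr_hom
    ((P.map φ).mapPresheaf.naturality (homOfLE hx).op) ((η.app M).app U s)
  change _ = (P.obj N).presheaf.map (homOfLE hx).op ((η.app N).app U (φ.app U s))
  rw [h₁]
  exact h₂

end Bundles

/-! ### Smooth hermitian metrics -/

section Metrics

variable {X : Scheme.{0}} [X.Over SpecC]

/-- A smooth hermitian metric on (the analytic bundle attached to) `M`: a hermitian inner product
on every fibre `M(x)`, `x ∈ X(ℂ)`, such that `x ↦ ⟨s(x), t(x)⟩` is smooth on `U(ℂ)` for all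
algebraic sections `s, t` over a Zariski open `U`. (An algebraic bundle has algebraic local frames,
so this says that the matrix of the metric in a local frame is smooth.) -/
structure HermitianMetric (M : X.Modules) where
  core : ∀ x : CPoint X, InnerProductSpace.Core ℂ (Fiber x M)
  smooth : ∀ (U : X.Opens) (s t : Γ(M, U)),
    IsSmoothFun (U := U) (fun x hx => (core x).inner (sectionValue x hx s) (sectionValue x hx t))

/-- The inner product of two vectors of the fibre at `x`. -/
def HermitianMetric.inner {M : X.Modules} (h : HermitianMetric M) (x : CPoint X)
    (u v : Fiber x M) : ℂ := (h.core x).inner u v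

lemma HermitianMetric.eq_zero_of_re {M : X.Modules} (h : HermitianMetric M) (x : CPoint X)
    (u : Fiber x M) (hu : RCLike.re (h.inner x u u) = 0) : u = 0 := by
  apply (h.core x).definite
  have him : RCLike.im (h.inner x u u) = 0 := by
    have := congrArg RCLike.im ((h.core x).conj_inner_symm u u)
    rw [RCLike.conj_im] at this
    change - RCLike.im (h.inner x u u) = RCLike.im (h.inner x u u) at this
    linarith
  exact RCLike.ext (hu.trans (map_zero _).symm) (him.trans (map_zero _).symm)

/-- The orthogonal sum metric on a module `B` presented as a direct sum of `A` and `C`, with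
projections `p`, `q` and inclusions `i`, `j`. -/
def HermitianMetric.orthSum {A B C : X.Modules} (hA : HermitianMetric A) (hC : HermitianMetric C)
    (p : B ⟶ A) (q : B ⟶ C) (i : A ⟶ B) (j : C ⟶ B) (hid : p ≫ i + q ≫ j = 𝟙 B) :
    HermitianMetric B where
  core x :=
    { inner := fun u v => hA.inner x (fiberMap x p u) (fiberMap x p v) +
        hC.inner x (fiberMap x q u) (fiberMap x q v)
      conj_inner_symm := fun u v => by
        rw [map_add]
        exact congrArg₂ (· + ·) ((hA.core x).conj_inner_symm _ _) ((hC.core x).conj_inner_symm _ _)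
      re_inner_nonneg := fun u => by
        rw [map_add]
        exact add_nonneg ((hA.core x).re_inner_nonneg _) ((hC.core x).re_inner_nonneg _)
      add_left := fun u v w => by
        have h₁ := (hA.core x).add_left (fiberMap x p u) (fiberMap x p v) (fiberMap x p w)
        have h₂ := (hC.core x).add_left (fiberMap x q u) (fiberMap x q v) (fiberMap x q w)
        simp only [map_add, HermitianMetric.inner] at *
        erw [h₁, h₂]
        ring
      smul_left := fun u v c => by
        have h₁ := (hA.core x).smul_left (fiberMap x p u) (fiberMap x p v) c
        have h₂ := (hC.core x).smul_left (fiberMap x q u) (fiberMap x q v) c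
        simp only [map_smul, HermitianMetric.inner] at *
        erw [h₁, h₂]
        ring
      definite := fun u hu => by
        have hre : RCLike.re (hA.inner x (fiberMap x p u) (fiberMap x p u)) +
            RCLike.re (hC.inner x (fiberMap x q u) (fiberMap x q u)) = 0 := by
          rw [← map_add]
          exact (congrArg RCLike.re hu).trans (map_zero _)
        have h₁ : 0 ≤ RCLike.re (hA.inner x (fiberMap x p u) (fiberMap x p u)) :=
          (hA.core x).re_inner_nonneg _
        have h₂ : 0 ≤ RCLike.re (hC.inner x (fiberMap x q u) (fiberMap x q u)) :=
          (hC.core x).re_inner_nonneg _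
        have e₁ : fiberMap x p u = 0 := hA.eq_zero_of_re x _ (by linarith)
        have e₂ : fiberMap x q u = 0 := hC.eq_zero_of_re x _ (by linarith)
        rw [← fiberMap_id x u, ← hid, fiberMap_add, fiberMap_comp, fiberMap_comp, e₁, e₂,
          map_zero, map_zero, add_zero] }
  smooth U s t := by
    have h₁ := hA.smooth U (p.app U s) (p.app U t)
    have h₂ := hC.smooth U (q.app U s) (q.app U t)
    simp only [← fiberMap_sectionValue] at h₁ h₂
    exact h₁.add h₂

/-- A short sequence `0 ⟶ A ⟶ B ⟶ C ⟶ 0` of bundles with metrics is orthogonally split if it is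
isometric to `0 ⟶ A ⟶ A ⊕ C ⟶ C ⟶ 0` with the orthogonal sum metric: there are algebraic
morphisms `r : B ⟶ A` and `s : C ⟶ B` splitting it, and the metric of `B` is the orthogonal sum
of those of `A` and `C` under the resulting isomorphism `(r, p) : B ≅ A ⊕ C`. -/
def IsOrthogonallySplitSES {A B C : X.Modules} (hA : HermitianMetric A) (hB : HermitianMetric B)
    (hC : HermitianMetric C) (i : A ⟶ B) (p : B ⟶ C) : Prop :=
  ∃ (r : B ⟶ A) (s : C ⟶ B), i ≫ r = 𝟙 A ∧ s ≫ p = 𝟙 C ∧ r ≫ i + p ≫ s = 𝟙 B ∧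
    ∀ (x : CPoint X) (u v : Fiber x B),
      hB.inner x u v = hA.inner x (fiberMap x r u) (fiberMap x r v) +
        hC.inner x (fiberMap x p u) (fiberMap x p v)

end Metrics

/-! ### Bounded complexes of hermitian vector bundles -/

variable (X : Scheme.{0}) [X.Over SpecC]

/-- A bounded complex of algebraic vector bundles on `X`, each with a smooth hermitian metric.
A morphism of such objects is a morphism of the underlying complexes. -/
structure HermCplx where
  cplx : CochainComplex X.Modules ℤ
  isVectorBundle : ∀ n, IsVectorBundle (cplx.X n)
  bounded : ∃ a b : ℤ, ∀ n, n < a ∨ b < n → IsZero (cplx.X n)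
  metric : ∀ n, HermitianMetric (cplx.X n)

variable {X}

namespace HermCplx

/-- The hermitian cone of a morphism of complexes: `cone(f)ⁿ = Eⁿ⁺¹ ⊕ Fⁿ` with differential
`(x, y) ↦ (-dx, f x + dy)`, with the orthogonal sum metric. -/
def cone {E F : HermCplx X} (f : E.cplx ⟶ F.cplx) : HermCplx X where
  cplx := CochainComplex.mappingCone f
  isVectorBundle n :=
    ((E.isVectorBundle (n + 1)).biprod (F.isVectorBundle n)).of_iso
      (HomologicalComplex.homotopyCofiber.XIsoBiprod f n (n + 1) rfl).symm
  bounded := by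
    obtain ⟨a, b, h⟩ := E.bounded
    obtain ⟨a', b', h'⟩ := F.bounded
    refine ⟨min (a - 1) a', max b b', fun n hn => ?_⟩
    rw [CochainComplex.mappingCone.isZero_X_iff]
    exact ⟨h _ (by omega), h' _ (by omega)⟩
  metric n := (E.metric (n + 1)).orthSum (F.metric n)
    ((CochainComplex.mappingCone.fst f).1.v n (n + 1) rfl)
    ((CochainComplex.mappingCone.snd f).v n n (add_zero n))
    ((CochainComplex.mappingCone.inl f).v (n + 1) n (by omega))
    ((CochainComplex.mappingCone.inr f).f n)
    (CochainComplex.mappingCone.id_X f n (n + 1) rfl)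

/-- The shift `E[1]`: `E[1]ⁿ = Eⁿ⁺¹` with differential `-d` and the metric of `Eⁿ⁺¹`. -/
def shift (E : HermCplx X) : HermCplx X where
  cplx := (CategoryTheory.shiftFunctor (CochainComplex X.Modules ℤ) (1 : ℤ)).obj E.cplx
  isVectorBundle n := E.isVectorBundle (n + 1)
  bounded := by
    obtain ⟨a, b, h⟩ := E.bounded
    exact ⟨a - 1, b, fun n hn => h (n + 1) (by omega)⟩
  metric n := E.metric (n + 1)

/-- The orthogonal direct sum of two complexes. -/
def directSum (E F : HermCplx X) : HermCplx X where
  cplx := E.cplx ⊞ F.cplx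
  isVectorBundle n :=
    ((E.isVectorBundle n).biprod (F.isVectorBundle n)).of_iso
      (((HomologicalComplex.eval X.Modules (ComplexShape.up ℤ) n).mapBiprod
        E.cplx F.cplx)).symm
  bounded := by
    obtain ⟨a, b, h⟩ := E.bounded
    obtain ⟨a', b', h'⟩ := F.bounded
    refine ⟨min a a', max b b', fun n hn => ?_⟩
    refine IsZero.of_iso ?_
      ((HomologicalComplex.eval X.Modules (ComplexShape.up ℤ) n).mapBiprod E.cplx F.cplx)
    rw [biprod_isZero_iff]
    exact ⟨h n (by omega), h' n (by omega)⟩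
  metric n := (E.metric n).orthSum (F.metric n)
    ((biprod.fst : E.cplx ⊞ F.cplx ⟶ E.cplx).f n) ((biprod.snd : E.cplx ⊞ F.cplx ⟶ F.cplx).f n)
    ((biprod.inl : E.cplx ⟶ E.cplx ⊞ F.cplx).f n) ((biprod.inr : F.cplx ⟶ E.cplx ⊞ F.cplx).f n)
    (by
      rw [← HomologicalComplex.comp_f, ← HomologicalComplex.comp_f,
        ← HomologicalComplex.add_f_apply, biprod.total, HomologicalComplex.id_f])

/-- `E` and `F` are isometric: there is an isomorphism of complexes that preserves the metrics in
every degree. -/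
def Isometric (E F : HermCplx X) : Prop :=
  ∃ e : E.cplx ≅ F.cplx, ∀ (n : ℤ) (x : CPoint X) (u v : Fiber x (E.cplx.X n)),
    (F.metric n).inner x (fiberMap x (e.hom.f n) u) (fiberMap x (e.hom.f n) v) =
      (E.metric n).inner x u v

/-- `E` is acyclic: its underlying complex is exact (as a complex of sheaves of modules). -/
def IsAcyclic (E : HermCplx X) : Prop := E.cplx.Acyclic

/-- `E` is orthogonally split: it is assembled from orthogonally split short exact sequences
`0 ⟶ Zⁿ ⟶ Eⁿ ⟶ Zⁿ⁺¹ ⟶ 0` of hermitian vector bundles, the differential being the composition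
`Eⁿ ⟶ Zⁿ⁺¹ ⟶ Eⁿ⁺¹`. Equivalently, it is isometric to an orthogonal direct sum of complexes
`0 ⟶ Z ⟶ Z ⟶ 0` given by identities. -/
def IsOrthogonallySplit (E : HermCplx X) : Prop :=
  ∃ (Z : ℤ → X.Modules) (h : ∀ n, HermitianMetric (Z n))
    (i : ∀ n, Z n ⟶ E.cplx.X n) (p : ∀ n, E.cplx.X n ⟶ Z (n + 1)),
    (∀ n, IsVectorBundle (Z n)) ∧
    (∀ n, IsOrthogonallySplitSES (h n) (E.metric n) (h (n + 1)) (i n) (p n)) ∧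
    ∀ n, E.cplx.d n (n + 1) = p n ≫ i (n + 1)

/-- A finite decreasing filtration of `E` by subcomplexes of vector bundles `Fil p` with the
metrics induced from `E`, such that, for all `p` and `n`, the sequence
`0 ⟶ Filᵖ⁺¹ Eⁿ ⟶ Filᵖ Eⁿ ⟶ Grᵖ Eⁿ ⟶ 0` is an orthogonally split short exact sequence of
hermitian vector bundles (in particular `Grᵖ` is the quotient complex and carries the quotient
metric). -/
structure OrthogonalFiltration (E : HermCplx X) where
  Fil : ℤ → HermCplx X
  emb : ∀ p, (Fil p).cplx ⟶ E.cplx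
  mono_emb : ∀ p, Mono (emb p)
  /-- `Fil p` carries the metric induced from `E`. -/
  inner_emb : ∀ (p n : ℤ) (x : CPoint X) (u v : Fiber x ((Fil p).cplx.X n)),
    (E.metric n).inner x (fiberMap x ((emb p).f n) u) (fiberMap x ((emb p).f n) v) =
      ((Fil p).metric n).inner x u v
  /-- The inclusion of `Fil (p + 1)` in `Fil p`. -/
  incl : ∀ p, (Fil (p + 1)).cplx ⟶ (Fil p).cplx
  incl_emb : ∀ p, incl p ≫ emb p = emb (p + 1)
  exists_top : ∃ a, IsIso (emb a)
  exists_bot : ∃ b, IsZero (Fil b).cplx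
  Gr : ℤ → HermCplx X
  proj : ∀ p, (Fil p).cplx ⟶ (Gr p).cplx
  split : ∀ p n : ℤ, IsOrthogonallySplitSES ((Fil (p + 1)).metric n) ((Fil p).metric n)
    ((Gr p).metric n) ((incl p).f n) ((proj p).f n)

end HermCplx

/-! ### Meager complexes -/

variable (X)

/-- The class `ℳ₀`: orthogonally split complexes, and complexes isometric to `F ⊕ F[1]` with `F`
acyclic. -/
def classM0 : Set (HermCplx X) :=
  {E | E.IsOrthogonallySplit ∨
    ∃ F : HermCplx X, F.IsAcyclic ∧ E.Isometric (F.directSum F.shift)}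

/-- A class of complexes has the two-out-of-three property for hermitian cones. -/
def TwoOutOfThree (C : Set (HermCplx X)) : Prop :=
  ∀ (E F : HermCplx X) (f : E.cplx ⟶ F.cplx),
    (E ∈ C → F ∈ C → HermCplx.cone f ∈ C) ∧
    (E ∈ C → HermCplx.cone f ∈ C → F ∈ C) ∧
    (F ∈ C → HermCplx.cone f ∈ C → E ∈ C)

/-- The class `ℳ` of meager complexes: the smallest class that contains `ℳ₀` and has the
two-out-of-three property for hermitian cones. -/
def meager : Set (HermCplx X) :=
  {E | ∀ C : Set (HermCplx X), classM0 X ⊆ C → TwoOutOfThree X C → E ∈ C}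

/-- The class `ℳ_F`: complexes with a finite filtration whose pieces are orthogonally split in
each degree and whose graded complexes belong to `ℳ₀`. -/
def classMF : Set (HermCplx X) :=
  {E | ∃ Φ : E.OrthogonalFiltration, ∀ p, Φ.Gr p ∈ classM0 X}

/-- The class `ℳ_S`: complexes `E` with a morphism `f : E ⟶ F` such that `F` and `cone(f)` belong
to `ℳ_F`. -/
def classMS : Set (HermCplx X) :=
  {E | ∃ (F : HermCplx X) (f : E.cplx ⟶ F.cplx), F ∈ classMF X ∧ HermCplx.cone f ∈ classMF X}

end HermitianComplexes

end

open CategoryTheory Limits AlgebraicGeometry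
open scoped ContDiff

noncomputable section

namespace HermitianComplexes

/-! ### Fibres and metrics -/

section Metrics

variable {X : Scheme.{0}} [X.Over SpecC]

/-! Everything is phrased with extensions `Ext A E C` that are orthogonally split in each degree by
maps that need not commute with the differentials. By `mem_classMF_iff`, ℳ_F consists of the
iterated extensions `IsFiltered` of complexes of ℳ₀; it is closed under extensions and shifts, and
contains the cone of every identity (`IsFiltered.cone_id`).

For ℳ ⊆ ℳ_S, a complex is called stably filtered if it is the kernel of such a split epimorphism
between filtered complexes. The cone constructions `ext_cone_incl` and `ext_cone_proj` show that
being a cokernel is equivalent (`of_quotient`, `exists_quotient`), and that stably filtered is the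
same as belonging to ℳ_S (`mem_classMS_iff`). With both descriptions available, cones, kernels and
cokernels against filtered complexes are controlled, which gives two-out-of-three
(`twoOutOfThree_isStablyFiltered`). Minimality of ℳ concludes.

For ℳ_S ⊆ ℳ, it suffices that a class with two-out-of-three containing ℳ₀ contains every filtered
complex (`IsFiltered.mem`). An extension of K by A is, up to shift, the cone of its connecting
morphism K → A[1] (`exists_cone_isometric_shift`). Such a class is not assumed stable under
isometry. For acyclic targets this stability holds by `mem_of_isometric`, because the cone of a zero
map between isometric complexes is of the form F ⊕ F[1]. -/

lemma fiberMap_zero (x : CPoint X) {M N : X.Modules} (u : Fiber x M) :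
    fiberMap x (0 : M ⟶ N) u = 0 := by
  have h := fiberMap_add x (0 : M ⟶ N) 0 u
  rw [add_zero] at h
  exact left_eq_add.mp h

lemma fiberMap_neg (x : CPoint X) {M N : X.Modules} (φ : M ⟶ N) (u : Fiber x M) :
    fiberMap x (-φ) u = -fiberMap x φ u := by
  rw [eq_neg_iff_add_eq_zero, ← fiberMap_add, neg_add_cancel, fiberMap_zero]

lemma fiber_eq_zero {M : X.Modules} (hM : IsZero M) (x : CPoint X) (u : Fiber x M) : u = 0 := by
  rw [← fiberMap_id x u, hM.eq_of_src (𝟙 M) 0, fiberMap_zero]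

namespace HermitianMetric

variable {M : X.Modules} (h : HermitianMetric M) (x : CPoint X)

lemma inner_add_left (u v w : Fiber x M) :
    h.inner x (u + v) w = h.inner x u w + h.inner x v w :=
  (h.core x).add_left u v w

lemma inner_smul_left (c : ℂ) (u v : Fiber x M) :
    h.inner x (c • u) v = (starRingEnd ℂ) c * h.inner x u v :=
  (h.core x).smul_left u v c

lemma conj_inner (u v : Fiber x M) : (starRingEnd ℂ) (h.inner x v u) = h.inner x u v :=
  (h.core x).conj_inner_symm u v

lemma inner_zero_left (v : Fiber x M) : h.inner x 0 v = 0 := by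
  have := h.inner_smul_left x 0 0 v
  simpa using this

lemma inner_neg_left (u v : Fiber x M) : h.inner x (-u) v = -h.inner x u v := by
  rw [eq_neg_iff_add_eq_zero, ← h.inner_add_left, neg_add_cancel, h.inner_zero_left]

lemma inner_neg_right (u v : Fiber x M) : h.inner x u (-v) = -h.inner x u v := by
  rw [← h.conj_inner, h.inner_neg_left, map_neg, h.conj_inner]

lemma inner_neg_neg (u v : Fiber x M) : h.inner x (-u) (-v) = h.inner x u v := by
  rw [h.inner_neg_left, h.inner_neg_right, neg_neg]

/-- Signs are isometries. This absorbs the sign that a shift puts on the differential. -/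
lemma inner_units_smul (ε : ℤˣ) {N : X.Modules} (φ : N ⟶ M) (u v : Fiber x N) :
    h.inner x (fiberMap x (ε • φ) u) (fiberMap x (ε • φ) v) =
      h.inner x (fiberMap x φ u) (fiberMap x φ v) := by
  rcases Int.units_eq_one_or ε with rfl | rfl
  · rw [one_smul]
  · rw [Units.neg_smul, one_smul, fiberMap_neg, fiberMap_neg, inner_neg_neg]

lemma orthSum_inner {A B C : X.Modules} (hA : HermitianMetric A) (hC : HermitianMetric C)
    (p : B ⟶ A) (q : B ⟶ C) (i : A ⟶ B) (j : C ⟶ B) (hid : p ≫ i + q ≫ j = 𝟙 B)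
    (x : CPoint X) (u v : Fiber x B) :
    (hA.orthSum hC p q i j hid).inner x u v =
      hA.inner x (fiberMap x p u) (fiberMap x p v) +
        hC.inner x (fiberMap x q u) (fiberMap x q v) := rfl

/-- The metric on a zero module. -/
def ofIsZero (hM : IsZero M) : HermitianMetric M where
  core x :=
    { inner := fun _ _ => 0
      conj_inner_symm := fun _ _ => map_zero _
      re_inner_nonneg := fun _ => le_of_eq (map_zero _).symm
      add_left := fun _ _ _ => (add_zero _).symm
      smul_left := fun _ _ _ => (mul_zero _).symm
      definite := fun u _ => fiber_eq_zero hM x u }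
  smooth U _ _ := fun _ hx => ⟨U, le_rfl, hx, 0, Fin.elim0, Set.univ, fun _ => 0, isOpen_univ,
    trivial, contDiffOn_const, fun _ _ _ => rfl⟩

/-- `φ` preserves the hermitian inner products of the fibres. -/
def Preserves {M N : X.Modules} (hM : HermitianMetric M) (hN : HermitianMetric N)
    (φ : M ⟶ N) : Prop :=
  ∀ (x : CPoint X) (u v : Fiber x M),
    hN.inner x (fiberMap x φ u) (fiberMap x φ v) = hM.inner x u v

namespace Preserves

variable {M N P : X.Modules} {hM : HermitianMetric M} {hN : HermitianMetric N}
  {hP : HermitianMetric P}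

lemma id (hM : HermitianMetric M) : hM.Preserves hM (𝟙 M) := fun x u v => by
  rw [fiberMap_id, fiberMap_id]

lemma comp {φ : M ⟶ N} {ψ : N ⟶ P} (h₁ : hM.Preserves hN φ) (h₂ : hN.Preserves hP ψ) :
    hM.Preserves hP (φ ≫ ψ) := fun x u v => by
  rw [fiberMap_comp, fiberMap_comp, h₂, h₁]

lemma inv {e : M ⟶ N} {e' : N ⟶ M} (h : hM.Preserves hN e) (he : e' ≫ e = 𝟙 N) :
    hN.Preserves hM e' := fun x u v => by
  rw [← h, ← fiberMap_comp, ← fiberMap_comp, he, fiberMap_id, fiberMap_id]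

end Preserves

end HermitianMetric

/-- The data of an orthogonally split short exact sequence, with chosen splittings. -/
structure OrthDecomp {A B C : X.Modules} (hA : HermitianMetric A) (hB : HermitianMetric B)
    (hC : HermitianMetric C) (i : A ⟶ B) (p : B ⟶ C) (r : B ⟶ A) (s : C ⟶ B) : Prop where
  i_r : i ≫ r = 𝟙 A
  s_p : s ≫ p = 𝟙 C
  total : r ≫ i + p ≫ s = 𝟙 B
  inner : ∀ (x : CPoint X) (u v : Fiber x B),
    hB.inner x u v = hA.inner x (fiberMap x r u) (fiberMap x r v) +
      hC.inner x (fiberMap x p u) (fiberMap x p v)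

lemma isOrthogonallySplitSES_iff {A B C : X.Modules} {hA : HermitianMetric A}
    {hB : HermitianMetric B} {hC : HermitianMetric C} {i : A ⟶ B} {p : B ⟶ C} :
    IsOrthogonallySplitSES hA hB hC i p ↔ ∃ r s, OrthDecomp hA hB hC i p r s :=
  ⟨fun ⟨r, s, h₁, h₂, h₃, h₄⟩ => ⟨r, s, h₁, h₂, h₃, h₄⟩,
    fun ⟨r, s, h⟩ => ⟨r, s, h.i_r, h.s_p, h.total, h.inner⟩⟩

namespace OrthDecomp

variable {A B C : X.Modules} {hA : HermitianMetric A} {hB : HermitianMetric B}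
  {hC : HermitianMetric C} {i : A ⟶ B} {p : B ⟶ C} {r : B ⟶ A} {s : C ⟶ B}

lemma i_r_assoc (h : OrthDecomp hA hB hC i p r s) {D : X.Modules} (f : A ⟶ D) :
    i ≫ r ≫ f = f := by
  rw [← Category.assoc, h.i_r, Category.id_comp]

lemma s_p_assoc (h : OrthDecomp hA hB hC i p r s) {D : X.Modules} (f : C ⟶ D) :
    s ≫ p ≫ f = f := by
  rw [← Category.assoc, h.s_p, Category.id_comp]

/-- Exactness is not among the fields. Composing `total` with `i` kills `i ≫ p ≫ s`, and `s` is a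
split monomorphism. -/
lemma i_p (h : OrthDecomp hA hB hC i p r s) : i ≫ p = 0 := by
  have h₁ : i ≫ (r ≫ i + p ≫ s) = i := by rw [h.total, Category.comp_id]
  rw [Preadditive.comp_add, h.i_r_assoc, add_eq_left] at h₁
  have h₂ : (i ≫ p ≫ s) ≫ p = 0 := by rw [h₁, zero_comp]
  simpa [h.s_p] using h₂

lemma s_r (h : OrthDecomp hA hB hC i p r s) : s ≫ r = 0 := by
  have h₁ : s ≫ (r ≫ i + p ≫ s) = s := by rw [h.total, Category.comp_id]
  rw [Preadditive.comp_add, h.s_p_assoc, add_eq_right] at h₁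
  have h₂ : (s ≫ r ≫ i) ≫ r = 0 := by rw [h₁, zero_comp]
  simpa [h.i_r] using h₂

lemma i_p_assoc (h : OrthDecomp hA hB hC i p r s) {D : X.Modules} (f : C ⟶ D) :
    i ≫ p ≫ f = 0 := by
  rw [← Category.assoc, h.i_p, zero_comp]

lemma s_r_assoc (h : OrthDecomp hA hB hC i p r s) {D : X.Modules} (f : A ⟶ D) :
    s ≫ r ≫ f = 0 := by
  rw [← Category.assoc, h.s_r, zero_comp]

lemma preserves_i (h : OrthDecomp hA hB hC i p r s) : hA.Preserves hB i := fun x u v => by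
  rw [h.inner, ← fiberMap_comp, ← fiberMap_comp, ← fiberMap_comp, ← fiberMap_comp, h.i_r, h.i_p,
    fiberMap_id, fiberMap_id, fiberMap_zero, fiberMap_zero, hC.inner_zero_left, add_zero]

lemma preserves_s (h : OrthDecomp hA hB hC i p r s) : hC.Preserves hB s := fun x u v => by
  rw [h.inner, ← fiberMap_comp, ← fiberMap_comp, ← fiberMap_comp, ← fiberMap_comp, h.s_p, h.s_r,
    fiberMap_id, fiberMap_id, fiberMap_zero, fiberMap_zero, hA.inner_zero_left, zero_add]

/-- Exchange the two orthogonal summands. -/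
lemma swap (h : OrthDecomp hA hB hC i p r s) : OrthDecomp hC hB hA s r p i where
  i_r := h.s_p
  s_p := h.i_r
  total := by rw [add_comm, h.total]
  inner x u v := by rw [h.inner, add_comm]

lemma ext_to (h : OrthDecomp hA hB hC i p r s) {D : X.Modules} {f g : D ⟶ B}
    (h₁ : f ≫ r = g ≫ r) (h₂ : f ≫ p = g ≫ p) : f = g := by
  rw [← Category.comp_id f, ← Category.comp_id g, ← h.total, Preadditive.comp_add,
    Preadditive.comp_add, reassoc_of% h₁, reassoc_of% h₂]

lemma ext_from (h : OrthDecomp hA hB hC i p r s) {D : X.Modules} {f g : B ⟶ D}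
    (h₁ : i ≫ f = i ≫ g) (h₂ : s ≫ f = s ≫ g) : f = g := by
  rw [← Category.id_comp f, ← Category.id_comp g, ← h.total, Preadditive.add_comp,
    Preadditive.add_comp, Category.assoc, Category.assoc, Category.assoc, Category.assoc, h₁, h₂]

lemma of_orthSum (hA : HermitianMetric A) (hC : HermitianMetric C) (hid : r ≫ i + p ≫ s = 𝟙 B)
    (h₁ : i ≫ r = 𝟙 A) (h₂ : s ≫ p = 𝟙 C) :
    OrthDecomp hA (hA.orthSum hC r p i s hid) hC i p r s :=
  ⟨h₁, h₂, hid, fun _ _ _ => rfl⟩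

/-- Replace the first summand by an isometric one. -/
lemma precomp (h : OrthDecomp hA hB hC i p r s) {A' : X.Modules} {hA' : HermitianMetric A'}
    {e : A' ⟶ A} {e' : A ⟶ A'} (h₁ : e ≫ e' = 𝟙 A') (h₂ : e' ≫ e = 𝟙 A)
    (he : hA'.Preserves hA e) : OrthDecomp hA' hB hC (e ≫ i) p (r ≫ e') s where
  i_r := by rw [Category.assoc, h.i_r_assoc, h₁]
  s_p := h.s_p
  total := by rw [Category.assoc, reassoc_of% h₂, h.total]
  inner x u v := by
    rw [h.inner, fiberMap_comp, fiberMap_comp, he.inv h₂]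

/-- Replace the second summand by an isometric one. -/
lemma postcomp (h : OrthDecomp hA hB hC i p r s) {C' : X.Modules} {hC' : HermitianMetric C'}
    {e : C ⟶ C'} {e' : C' ⟶ C} (h₁ : e ≫ e' = 𝟙 C) (h₂ : e' ≫ e = 𝟙 C')
    (he : hC.Preserves hC' e) : OrthDecomp hA hB hC' i (p ≫ e) r (e' ≫ s) :=
  (h.swap.precomp h₂ h₁ (he.inv h₂)).swap

/-- Replace the total space by an isometric one. -/
lemma conj (h : OrthDecomp hA hB hC i p r s) {B' : X.Modules} {hB' : HermitianMetric B'}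
    {e : B ⟶ B'} {e' : B' ⟶ B} (h₁ : e ≫ e' = 𝟙 B) (h₂ : e' ≫ e = 𝟙 B')
    (he : hB.Preserves hB' e) : OrthDecomp hA hB' hC (i ≫ e) (e' ≫ p) (e' ≫ r) (s ≫ e) where
  i_r := by rw [Category.assoc, reassoc_of% h₁, h.i_r]
  s_p := by rw [Category.assoc, reassoc_of% h₁, h.s_p]
  total := by
    calc (e' ≫ r) ≫ i ≫ e + (e' ≫ p) ≫ s ≫ e = e' ≫ (r ≫ i + p ≫ s) ≫ e := by
          simp only [Preadditive.comp_add, Preadditive.add_comp, Category.assoc]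
      _ = 𝟙 B' := by rw [h.total, Category.id_comp, h₂]
  inner x u v := by
    rw [← he.inv h₂, h.inner]
    simp only [fiberMap_comp]

end OrthDecomp

end Metrics

/-! ### Zero bundles, and compositions of orthogonal decompositions -/

section Decompositions

variable {X : Scheme.{0}}

lemma isZero_free_pempty (U : Scheme.{0}) :
    IsZero (SheafOfModules.free (R := U.ringCatSheaf) PEmpty.{1}) := by
  refine (IsZero.iff_id_eq_zero _).2 ?_
  refine Sigma.hom_ext (C := SheafOfModules U.ringCatSheaf) _ _ fun b => b.elim

lemma IsVectorBundle.of_isZero {M : X.Modules} (hM : IsZero M) : IsVectorBundle M := fun x => by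
  refine ⟨⊤, trivial, PEmpty, inferInstance, ⟨?_⟩⟩
  have h₁ : IsZero (M.restrict (⊤ : X.Opens).ι) :=
    (Scheme.Modules.restrictFunctor (⊤ : X.Opens).ι).map_isZero hM
  exact h₁.iso (isZero_free_pempty _)

variable [X.Over SpecC]

namespace OrthDecomp

variable {A B C : X.Modules} {hA : HermitianMetric A} {hB : HermitianMetric B}
  {hC : HermitianMetric C} {i : A ⟶ B} {p : B ⟶ C} {r : B ⟶ A} {s : C ⟶ B}

lemma biprodSum (hA : HermitianMetric A) (hC : HermitianMetric C) :
    OrthDecomp hA (hA.orthSum hC biprod.fst biprod.snd biprod.inl biprod.inr biprod.total) hC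
      biprod.inl biprod.snd biprod.fst biprod.inr :=
  of_orthSum hA hC biprod.total biprod.inl_fst biprod.inr_snd

/-- The preimage in `B` of an orthogonal summand `C'` of the quotient `C`. -/
lemma preimage (h : OrthDecomp hA hB hC i p r s) {C' C'' : X.Modules}
    {hC' : HermitianMetric C'} {hC'' : HermitianMetric C''} {i' : C' ⟶ C} {p' : C ⟶ C''}
    {r' : C ⟶ C'} {s' : C'' ⟶ C} (h' : OrthDecomp hC' hC hC'' i' p' r' s') :
    OrthDecomp (hA.orthSum hC' biprod.fst biprod.snd biprod.inl biprod.inr biprod.total) hB hC''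
      (biprod.desc i (i' ≫ s)) (p ≫ p') (biprod.lift r (p ≫ r')) (s' ≫ s) where
  i_r := by
    apply biprod.hom_ext' <;> apply biprod.hom_ext <;>
      simp [h.i_r, h.i_p_assoc, h.s_r, h.s_p_assoc, h'.i_r]
  s_p := by simp [h.s_p_assoc, h'.s_p]
  total := by
    rw [biprod.lift_desc, add_assoc]
    calc r ≫ i + ((p ≫ r') ≫ i' ≫ s + (p ≫ p') ≫ s' ≫ s)
        = r ≫ i + p ≫ (r' ≫ i' + p' ≫ s') ≫ s := by
          simp only [Preadditive.comp_add, Preadditive.add_comp, Category.assoc]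
      _ = _ := by rw [h'.total, Category.id_comp, h.total]
  inner x u v := by
    rw [h.inner, h'.inner, HermitianMetric.orthSum_inner]
    simp only [← fiberMap_comp, biprod.lift_fst, biprod.lift_snd, add_assoc]

/-- The quotient of `B` by an orthogonal summand `A'` of the sub `A`. -/
lemma quotient (h : OrthDecomp hA hB hC i p r s) {A' A'' : X.Modules}
    {hA' : HermitianMetric A'} {hA'' : HermitianMetric A''} {i' : A' ⟶ A} {p' : A ⟶ A''}
    {r' : A ⟶ A'} {s' : A'' ⟶ A} (h' : OrthDecomp hA' hA hA'' i' p' r' s') :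
    OrthDecomp hA' hB
      (hA''.orthSum hC biprod.fst biprod.snd biprod.inl biprod.inr biprod.total)
      (i' ≫ i) (biprod.lift (r ≫ p') p) (r ≫ r') (biprod.desc (s' ≫ i) s) where
  i_r := by simp [h.i_r_assoc, h'.i_r]
  s_p := by
    apply biprod.hom_ext' <;> apply biprod.hom_ext <;>
      simp [h.i_r_assoc, h.i_p, h.s_r_assoc, h.s_p, h'.s_p]
  total := by
    rw [biprod.lift_desc, ← add_assoc]
    calc (r ≫ r') ≫ i' ≫ i + (r ≫ p') ≫ s' ≫ i + p ≫ s
        = r ≫ (r' ≫ i' + p' ≫ s') ≫ i + p ≫ s := by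
          simp only [Preadditive.comp_add, Preadditive.add_comp, Category.assoc]
      _ = _ := by rw [h'.total, Category.id_comp, h.total]
  inner x u v := by
    rw [h.inner, h'.inner, HermitianMetric.orthSum_inner]
    simp only [← fiberMap_comp, biprod.lift_fst, biprod.lift_snd, add_assoc]

end OrthDecomp

end Decompositions

namespace HermCplx

variable {X : Scheme.{0}} [X.Over SpecC]

/-! ### Isometries -/

lemma isometric_iff {E F : HermCplx X} :
    E.Isometric F ↔ ∃ e : E.cplx ≅ F.cplx, ∀ n, (E.metric n).Preserves (F.metric n) (e.hom.f n) :=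
  Iff.rfl

lemma Isometric.refl (E : HermCplx X) : E.Isometric E :=
  isometric_iff.2 ⟨Iso.refl _, fun _ => .id _⟩

lemma Isometric.symm {E F : HermCplx X} (h : E.Isometric F) : F.Isometric E := by
  obtain ⟨e, he⟩ := isometric_iff.1 h
  refine isometric_iff.2 ⟨e.symm, fun n => (he n).inv ?_⟩
  rw [Iso.symm_hom, ← HomologicalComplex.comp_f, e.inv_hom_id, HomologicalComplex.id_f]

lemma Isometric.trans {E F G : HermCplx X} (h : E.Isometric F) (h' : F.Isometric G) :
    E.Isometric G := by
  obtain ⟨e, he⟩ := isometric_iff.1 h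
  obtain ⟨e', he'⟩ := isometric_iff.1 h'
  exact isometric_iff.2 ⟨e ≪≫ e', fun n => (he n).comp (he' n)⟩

/-! ### Extensions that are orthogonally split in each degree -/

/-- The sequence `0 ⟶ A ⟶ E ⟶ C ⟶ 0` is orthogonally split in each degree. -/
def IsExt {A E C : HermCplx X} (i : A.cplx ⟶ E.cplx) (p : E.cplx ⟶ C.cplx) : Prop :=
  ∀ n, IsOrthogonallySplitSES (A.metric n) (E.metric n) (C.metric n) (i.f n) (p.f n)

/-- `E` is an extension of `C` by `A` that is orthogonally split in each degree. -/
def Ext (A E C : HermCplx X) : Prop :=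
  ∃ (i : A.cplx ⟶ E.cplx) (p : E.cplx ⟶ C.cplx), IsExt i p

lemma IsExt.exists_decomp {A E C : HermCplx X} {i : A.cplx ⟶ E.cplx} {p : E.cplx ⟶ C.cplx}
    (h : IsExt i p) : ∃ (r : ∀ n, E.cplx.X n ⟶ A.cplx.X n) (s : ∀ n, C.cplx.X n ⟶ E.cplx.X n),
      ∀ n, OrthDecomp (A.metric n) (E.metric n) (C.metric n) (i.f n) (p.f n) (r n) (s n) := by
  choose r s h using fun n => isOrthogonallySplitSES_iff.1 (h n)
  exact ⟨r, s, h⟩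

lemma IsExt.of_decomp {A E C : HermCplx X} {i : A.cplx ⟶ E.cplx} {p : E.cplx ⟶ C.cplx}
    {r : ∀ n, E.cplx.X n ⟶ A.cplx.X n} {s : ∀ n, C.cplx.X n ⟶ E.cplx.X n}
    (h : ∀ n, OrthDecomp (A.metric n) (E.metric n) (C.metric n) (i.f n) (p.f n) (r n) (s n)) :
    IsExt i p :=
  fun n => isOrthogonallySplitSES_iff.2 ⟨_, _, h n⟩

lemma hom_f_inv_f {E F : HermCplx X} (e : E.cplx ≅ F.cplx) (n : ℤ) :
    e.hom.f n ≫ e.inv.f n = 𝟙 _ := by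
  rw [← HomologicalComplex.comp_f, e.hom_inv_id, HomologicalComplex.id_f]

lemma inv_f_hom_f {E F : HermCplx X} (e : E.cplx ≅ F.cplx) (n : ℤ) :
    e.inv.f n ≫ e.hom.f n = 𝟙 _ := by
  rw [← HomologicalComplex.comp_f, e.inv_hom_id, HomologicalComplex.id_f]

lemma Ext.congr_left {A A' E C : HermCplx X} (h : Ext A E C) (hA : A'.Isometric A) :
    Ext A' E C := by
  obtain ⟨i, p, h⟩ := h
  obtain ⟨r, s, h⟩ := h.exists_decomp
  obtain ⟨e, he⟩ := isometric_iff.1 hA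
  exact ⟨e.hom ≫ i, p, .of_decomp fun n =>
    (h n).precomp (hom_f_inv_f e n) (inv_f_hom_f e n) (he n)⟩

lemma Ext.congr_right {A E C C' : HermCplx X} (h : Ext A E C) (hC : C.Isometric C') :
    Ext A E C' := by
  obtain ⟨i, p, h⟩ := h
  obtain ⟨r, s, h⟩ := h.exists_decomp
  obtain ⟨e, he⟩ := isometric_iff.1 hC
  exact ⟨i, p ≫ e.hom, .of_decomp fun n =>
    (h n).postcomp (hom_f_inv_f e n) (inv_f_hom_f e n) (he n)⟩

lemma Ext.congr_middle {A E E' C : HermCplx X} (h : Ext A E C) (hE : E.Isometric E') :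
    Ext A E' C := by
  obtain ⟨i, p, h⟩ := h
  obtain ⟨r, s, h⟩ := h.exists_decomp
  obtain ⟨e, he⟩ := isometric_iff.1 hE
  exact ⟨i ≫ e.hom, e.inv ≫ p, .of_decomp fun n =>
    (h n).conj (hom_f_inv_f e n) (inv_f_hom_f e n) (he n)⟩

/-- The complex is zero. -/
def IsZeroCplx (E : HermCplx X) : Prop := ∀ n, IsZero (E.cplx.X n)

variable (X) in
open ZeroObject in
/-- The zero complex. -/
def zero : HermCplx X where
  cplx := { X := fun _ => 0, d := fun _ _ => 0 }
  isVectorBundle _ := .of_isZero (isZero_zero _)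
  bounded := ⟨0, 0, fun _ _ => isZero_zero _⟩
  metric _ := .ofIsZero (isZero_zero _)

lemma isZeroCplx_of_isZero {E : HermCplx X} (h : IsZero E.cplx) : E.IsZeroCplx := fun n =>
  (HomologicalComplex.eval X.Modules (ComplexShape.up ℤ) n).map_isZero h

lemma IsZeroCplx.isZero {E : HermCplx X} (h : E.IsZeroCplx) : IsZero E.cplx :=
  (IsZero.iff_id_eq_zero _).2 (HomologicalComplex.hom_ext _ _ fun n => (h n).eq_of_src _ _)

lemma isZeroCplx_zero : (zero X).IsZeroCplx := fun _ => isZero_zero _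

/-- Degenerate extensions serve as one row of a morphism of extensions; taking cones of its columns
then yields extensions between cones of different shapes. -/
lemma isExt_self_right (E : HermCplx X) {Z : HermCplx X} (hZ : Z.IsZeroCplx) :
    IsExt (𝟙 E.cplx) (0 : E.cplx ⟶ Z.cplx) :=
  .of_decomp (r := fun n => 𝟙 _) (s := fun n => 0) fun n =>
    ⟨by simp, (hZ n).eq_of_src _ _, by simp, fun x u v => by
      rw [fiberMap_id, fiberMap_id, fiber_eq_zero (hZ n) x (fiberMap x _ u),
        HermitianMetric.inner_zero_left, add_zero]⟩

lemma isExt_self_left (E : HermCplx X) {Z : HermCplx X} (hZ : Z.IsZeroCplx) :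
    IsExt (0 : Z.cplx ⟶ E.cplx) (𝟙 E.cplx) :=
  .of_decomp (r := fun n => 0) (s := fun n => 𝟙 _) fun n =>
    ⟨(hZ n).eq_of_src _ _, by simp, by simp, fun x u v => by
      rw [HomologicalComplex.id_f, fiberMap_id, fiberMap_id,
        fiber_eq_zero (hZ n) x (fiberMap x _ u), HermitianMetric.inner_zero_left, zero_add]⟩

lemma ext_self_right {E Z : HermCplx X} (hZ : Z.IsZeroCplx) : Ext E E Z :=
  ⟨_, _, isExt_self_right E hZ⟩

lemma ext_self_left {E Z : HermCplx X} (hZ : Z.IsZeroCplx) : Ext Z E E :=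
  ⟨_, _, isExt_self_left E hZ⟩

lemma IsExt.w {A E C : HermCplx X} {i : A.cplx ⟶ E.cplx} {p : E.cplx ⟶ C.cplx}
    (h : IsExt i p) : i ≫ p = 0 := by
  obtain ⟨r, s, h⟩ := h.exists_decomp
  ext n : 1
  simp [(h n).i_p]

lemma IsExt.isIso_left {A E C : HermCplx X} {i : A.cplx ⟶ E.cplx} {p : E.cplx ⟶ C.cplx}
    (h : IsExt i p) (hC : C.IsZeroCplx) : IsIso i := by
  obtain ⟨r, s, h⟩ := h.exists_decomp
  have : ∀ n, IsIso (i.f n) := fun n => ⟨r n, (h n).i_r, by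
    rw [← (h n).total, (hC n).eq_of_src (s n) 0, comp_zero, add_zero]⟩
  exact HomologicalComplex.Hom.isIso_of_components i

lemma Ext.isometric_left {A E C : HermCplx X} (h : Ext A E C) (hC : C.IsZeroCplx) :
    A.Isometric E := by
  obtain ⟨i, p, h⟩ := h
  have := h.isIso_left hC
  obtain ⟨r, s, h⟩ := h.exists_decomp
  exact isometric_iff.2 ⟨asIso i, fun n => (h n).preserves_i⟩

lemma Ext.isometric_right {A E C : HermCplx X} (h : Ext A E C) (hA : A.IsZeroCplx) :
    E.Isometric C := by
  obtain ⟨i, p, h⟩ := h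
  obtain ⟨r, s, h⟩ := h.exists_decomp
  have h' : ∀ n, p.f n ≫ s n = 𝟙 _ := fun n => by
    rw [← (h n).total, (hA n).eq_of_src (i.f n) 0, comp_zero, zero_add]
  have : ∀ n, IsIso (p.f n) := fun n => ⟨s n, h' n, (h n).s_p⟩
  have := HomologicalComplex.Hom.isIso_of_components p
  exact isometric_iff.2 ⟨asIso p, fun n => (h n).preserves_s.inv (h' n)⟩

/-! ### Subcomplexes and quotient complexes given by degreewise data -/

/-- The complex with terms `K n`, retracts of the terms of `E`, and the differential induced by
that of `E`. -/
def retract (E : HermCplx X) (K : ℤ → X.Modules) (hK : ∀ n, IsVectorBundle (K n))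
    (m : ∀ n, HermitianMetric (K n)) (j : ∀ n, K n ⟶ E.cplx.X n) (q : ∀ n, E.cplx.X n ⟶ K n)
    (hjq : ∀ n, j n ≫ q n = 𝟙 _)
    (hd : ∀ a b c, (j a ≫ E.cplx.d a b ≫ q b) ≫ j b ≫ E.cplx.d b c ≫ q c = 0) :
    HermCplx X where
  cplx :=
    { X := K
      d := fun a b => j a ≫ E.cplx.d a b ≫ q b
      shape := fun a b h => by rw [E.cplx.shape a b h, zero_comp, comp_zero]
      d_comp_d' := fun a b c _ _ => hd a b c }
  isVectorBundle := hK
  bounded := by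
    obtain ⟨a, b, h⟩ := E.bounded
    refine ⟨a, b, fun n hn => (IsZero.iff_id_eq_zero _).2 ?_⟩
    rw [← hjq, (h n hn).eq_of_tgt (j n) 0, zero_comp]
  metric := m

section

variable {E : HermCplx X} {A C : ℤ → X.Modules} {hA : ∀ n, HermitianMetric (A n)}
  {hC : ∀ n, HermitianMetric (C n)} {i : ∀ n, A n ⟶ E.cplx.X n} {p : ∀ n, E.cplx.X n ⟶ C n}
  {r : ∀ n, E.cplx.X n ⟶ A n} {s : ∀ n, C n ⟶ E.cplx.X n}

/-- The subcomplex of `E` with terms `A n`. -/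
def sub (vA : ∀ n, IsVectorBundle (A n))
    (h : ∀ n, OrthDecomp (hA n) (E.metric n) (hC n) (i n) (p n) (r n) (s n))
    (hd : ∀ a b, i a ≫ E.cplx.d a b ≫ p b = 0) : HermCplx X :=
  E.retract A vA hA i r (fun n => (h n).i_r) (fun a b c => by
    -- By `hd` the differential of `E` maps `A` into `A`, so the compressed differential is its
    -- restriction and squares to zero.
    have h₁ : i a ≫ E.cplx.d a b = (i a ≫ E.cplx.d a b ≫ r b) ≫ i b :=
      (h b).ext_to (by simp [(h b).i_r]) (by simp [hd, (h b).i_p])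
    rw [← Category.assoc, ← h₁]
    simp)

/-- The quotient complex of `E` with terms `C n`. -/
def quot (vC : ∀ n, IsVectorBundle (C n))
    (h : ∀ n, OrthDecomp (hA n) (E.metric n) (hC n) (i n) (p n) (r n) (s n))
    (hd : ∀ a b, i a ≫ E.cplx.d a b ≫ p b = 0) : HermCplx X :=
  E.retract C vC hC s p (fun n => (h n).s_p) (fun a b c => by
    -- Dually, `d` followed by the projection depends only on the class in the quotient, so the
    -- compressed differential is the induced one.
    have h₁ : E.cplx.d b c ≫ p c = p b ≫ s b ≫ E.cplx.d b c ≫ p c :=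
      (h b).ext_from (by rw [hd, (h b).i_p_assoc])
        (by rw [(h b).s_p_assoc])
    simp only [Category.assoc]
    rw [← h₁]
    simp)

variable (vA : ∀ n, IsVectorBundle (A n)) (vC : ∀ n, IsVectorBundle (C n))
  (h : ∀ n, OrthDecomp (hA n) (E.metric n) (hC n) (i n) (p n) (r n) (s n))
  (hd : ∀ a b, i a ≫ E.cplx.d a b ≫ p b = 0)

/-- The inclusion of a subcomplex. -/
def subι : (sub vA h hd).cplx ⟶ E.cplx where
  f := i
  comm' a b _ := (h b).ext_to (by simp [sub, retract, (h b).i_r])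
    (by simp [sub, retract, hd, (h b).i_p])

/-- The projection to a quotient complex. -/
def quotπ : E.cplx ⟶ (quot vC h hd).cplx where
  f := p
  comm' a b _ := (h a).ext_from (by simp [quot, retract, hd, (h a).i_p_assoc])
    (by simp [quot, retract, (h a).s_p_assoc])

lemma isExt_sub_quot : IsExt (subι vA h hd) (quotπ vC h hd) := .of_decomp h

end

/-- The preimage of a subcomplex of the quotient. -/
lemma Ext.preimage {A E C C' C'' : HermCplx X} (h : Ext A E C) (h' : Ext C' C C'') :
    ∃ E', Ext A E' C' ∧ Ext E' E C'' := by
  obtain ⟨i, p, h⟩ := h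
  obtain ⟨i', p', h'⟩ := h'
  obtain ⟨r, s, h⟩ := h.exists_decomp
  obtain ⟨r', s', h'⟩ := h'.exists_decomp
  have H := fun n => (h n).preimage (h' n)
  -- The new terms are the kernel of the morphism of complexes `p ≫ p'`, hence stable under the
  -- differential even though `s` is not a chain map.
  have hd : ∀ a b, biprod.desc (i.f a) (i'.f a ≫ s a) ≫ E.cplx.d a b ≫ p.f b ≫ p'.f b = 0 := by
    intro a b
    rw [← p.comm_assoc, ← p'.comm, ← Category.assoc (p.f a), (H a).i_p_assoc]
  have v := fun n => (A.isVectorBundle n).biprod (C'.isVectorBundle n)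
  have e : ∀ n, biprod.desc (i.f n) (i'.f n ≫ s n) ≫ p.f n = biprod.snd ≫ i'.f n := fun n => by
    apply biprod.hom_ext' <;> simp [(h n).i_p, (h n).s_p]
  have e' : ∀ n, i.f n ≫ biprod.lift (r n) (p.f n ≫ r' n) = biprod.inl := fun n => by
    apply biprod.hom_ext <;> simp [(h n).i_r, (h n).i_p_assoc]
  refine ⟨sub v H hd, ⟨⟨fun n => biprod.inl, ?_⟩, ⟨fun n => biprod.snd, ?_⟩,
    .of_decomp fun n => .biprodSum _ _⟩, ⟨subι v H hd, p ≫ p', .of_decomp H⟩⟩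
  · intro a b _
    simp only [sub, retract, biprod.inl_desc_assoc]
    rw [i.comm_assoc, e']
  · intro a b _
    simp only [sub, retract, Category.assoc, biprod.lift_snd]
    rw [← p.comm_assoc, reassoc_of% (e a), i'.comm_assoc, (h' b).i_r, Category.comp_id]

/-- The quotient by a subcomplex of the sub. -/
lemma Ext.quotient {A E C A' A'' : HermCplx X} (h : Ext A E C) (h' : Ext A' A A'') :
    ∃ E'', Ext A' E E'' ∧ Ext A'' E'' C := by
  obtain ⟨i, p, h⟩ := h
  obtain ⟨i', p', h'⟩ := h'
  obtain ⟨r, s, h⟩ := h.exists_decomp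
  obtain ⟨r', s', h'⟩ := h'.exists_decomp
  have H := fun n => (h n).quotient (h' n)
  have hd : ∀ a b, (i'.f a ≫ i.f a) ≫ E.cplx.d a b ≫ biprod.lift (r b ≫ p'.f b) (p.f b) = 0 := by
    intro a b
    rw [Category.assoc, i.comm_assoc, i'.comm_assoc, ← Category.assoc (i'.f b), (H b).i_p,
      comp_zero]
  have v := fun n => (A''.isVectorBundle n).biprod (C.isVectorBundle n)
  have e : ∀ n, i.f n ≫ biprod.lift (r n ≫ p'.f n) (p.f n) = p'.f n ≫ biprod.inl := fun n => by
    apply biprod.hom_ext <;> simp [(h n).i_r_assoc, (h n).i_p]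
  have e' : ∀ n, biprod.desc (s' n ≫ i.f n) (s n) ≫ p.f n = biprod.snd := fun n => by
    apply biprod.hom_ext' <;> simp [(h n).i_p, (h n).s_p]
  refine ⟨quot v H hd, ⟨i' ≫ i, quotπ v H hd, .of_decomp H⟩, ⟨⟨fun n => biprod.inl, ?_⟩,
    ⟨fun n => biprod.snd, ?_⟩, .of_decomp fun n => .biprodSum _ _⟩⟩
  · intro a b _
    simp only [quot, retract, biprod.inl_desc_assoc, Category.assoc]
    rw [i.comm_assoc, e, ← p'.comm_assoc, reassoc_of% ((h' a).s_p)]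
  · intro a b _
    simp only [quot, retract, Category.assoc, biprod.lift_snd]
    rw [← p.comm, reassoc_of% (e' a)]

/-! ### Hermitian cones -/

section Cone

variable {E F : HermCplx X} (f : E.cplx ⟶ F.cplx)

/-- The projection of `cone(f)ⁿ` to `Eⁿ⁺¹`. -/
def coneFst (n : ℤ) : (cone f).cplx.X n ⟶ E.cplx.X (n + 1) :=
  (CochainComplex.mappingCone.fst f).1.v n (n + 1) rfl

/-- The projection of `cone(f)ⁿ` to `Fⁿ`. -/
def coneSnd (n : ℤ) : (cone f).cplx.X n ⟶ F.cplx.X n :=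
  (CochainComplex.mappingCone.snd f).v n n (add_zero n)

/-- The inclusion of `Eⁿ⁺¹` in `cone(f)ⁿ`. -/
def coneInl (n : ℤ) : E.cplx.X (n + 1) ⟶ (cone f).cplx.X n :=
  (CochainComplex.mappingCone.inl f).v (n + 1) n (by omega)

/-- The inclusion of `F` in `cone(f)`. -/
def coneInr : F.cplx ⟶ (cone f).cplx := CochainComplex.mappingCone.inr f

@[simp]
lemma coneInl_fst (n : ℤ) : coneInl f n ≫ coneFst f n = 𝟙 _ :=
  CochainComplex.mappingCone.inl_v_fst_v f _ _ _

@[simp]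
lemma coneInl_fst_assoc (n : ℤ) {D : X.Modules} (g : E.cplx.X (n + 1) ⟶ D) :
    coneInl f n ≫ coneFst f n ≫ g = g := by
  rw [← Category.assoc, coneInl_fst, Category.id_comp]

@[simp]
lemma coneInl_snd (n : ℤ) : coneInl f n ≫ coneSnd f n = 0 :=
  CochainComplex.mappingCone.inl_v_snd_v f _ _ _

@[simp]
lemma coneInl_snd_assoc (n : ℤ) {D : X.Modules} (g : F.cplx.X n ⟶ D) :
    coneInl f n ≫ coneSnd f n ≫ g = 0 := by
  rw [← Category.assoc, coneInl_snd, zero_comp]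

@[simp]
lemma coneInr_fst (n : ℤ) : (coneInr f).f n ≫ coneFst f n = 0 :=
  CochainComplex.mappingCone.inr_f_fst_v f _ _ _

@[simp]
lemma coneInr_fst_assoc (n : ℤ) {D : X.Modules} (g : E.cplx.X (n + 1) ⟶ D) :
    (coneInr f).f n ≫ coneFst f n ≫ g = 0 := by
  rw [← Category.assoc, coneInr_fst, zero_comp]

@[simp]
lemma coneInr_snd (n : ℤ) : (coneInr f).f n ≫ coneSnd f n = 𝟙 _ :=
  CochainComplex.mappingCone.inr_f_snd_v f _

@[simp]
lemma coneInr_snd_assoc (n : ℤ) {D : X.Modules} (g : F.cplx.X n ⟶ D) :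
    (coneInr f).f n ≫ coneSnd f n ≫ g = g := by
  rw [← Category.assoc, coneInr_snd, Category.id_comp]

lemma cone_d_fst (n : ℤ) : (cone f).cplx.d n (n + 1) ≫ coneFst f (n + 1) =
    -(coneFst f n ≫ E.cplx.d (n + 1) (n + 1 + 1)) :=
  CochainComplex.mappingCone.d_fst_v f _ _ _ rfl rfl

lemma cone_d_fst_assoc (n : ℤ) {D : X.Modules} (g : E.cplx.X (n + 1 + 1) ⟶ D) :
    (cone f).cplx.d n (n + 1) ≫ coneFst f (n + 1) ≫ g =
      -(coneFst f n ≫ E.cplx.d (n + 1) (n + 1 + 1) ≫ g) := by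
  rw [← Category.assoc, cone_d_fst, Preadditive.neg_comp, Category.assoc]

lemma cone_d_snd (n : ℤ) : (cone f).cplx.d n (n + 1) ≫ coneSnd f (n + 1) =
    coneFst f n ≫ f.f (n + 1) + coneSnd f n ≫ F.cplx.d n (n + 1) :=
  CochainComplex.mappingCone.d_snd_v f _ _ rfl

lemma cone_d_snd_assoc (n : ℤ) {D : X.Modules} (g : F.cplx.X (n + 1) ⟶ D) :
    (cone f).cplx.d n (n + 1) ≫ coneSnd f (n + 1) ≫ g =
      coneFst f n ≫ f.f (n + 1) ≫ g + coneSnd f n ≫ F.cplx.d n (n + 1) ≫ g := by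
  rw [← Category.assoc, cone_d_snd, Preadditive.add_comp, Category.assoc, Category.assoc]

lemma cone_total (n : ℤ) :
    coneFst f n ≫ coneInl f n + coneSnd f n ≫ (coneInr f).f n = 𝟙 _ :=
  CochainComplex.mappingCone.id_X f n (n + 1) rfl

/-- Provides coordinates on a cone: through `ext_to`, identities of maps into it are checked on the
two components. -/
lemma cone_decomp (n : ℤ) : OrthDecomp (E.metric (n + 1)) ((cone f).metric n) (F.metric n)
    (coneInl f n) (coneSnd f n) (coneFst f n) ((coneInr f).f n) :=
  .of_orthSum _ _ (cone_total f n) (coneInl_fst f n) (coneInr_snd f n)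

lemma shift_d (E : HermCplx X) (a b : ℤ) :
    E.shift.cplx.d a b = -E.cplx.d (a + 1) (b + 1) := by
  refine (CochainComplex.shiftFunctor_obj_d' E.cplx 1 a b).trans ?_
  rw [Int.negOnePow_one, Units.neg_smul, one_smul]

/-- The projection of `cone(f)` to `E[1]`. -/
def coneProj : (cone f).cplx ⟶ E.shift.cplx where
  f := coneFst f
  comm' a b hab := by
    obtain rfl : a + 1 = b := hab
    exact ((congrArg (fun g => coneFst f a ≫ g) (shift_d E a (a + 1))).trans
      (Preadditive.comp_neg _ _)).trans (cone_d_fst f a).symm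

lemma isExt_cone : IsExt (coneInr f) (coneProj f) :=
  .of_decomp fun n => (cone_decomp f n).swap

lemma ext_cone : Ext F (cone f) E.shift := ⟨_, _, isExt_cone f⟩

/-- One end of the extension `ext_cone` vanishes. With its companion below, this identifies the
degenerate cones arising from degenerate extensions. -/
lemma cone_isometric_of_isZero_source (hE : E.IsZeroCplx) : F.Isometric (cone f) :=
  (ext_cone f).isometric_left fun n => hE (n + 1)

lemma cone_isometric_of_isZero_target (hF : F.IsZeroCplx) : (cone f).Isometric E.shift :=
  (ext_cone f).isometric_right hF

/-- A morphism of cones induced by a commutative square. -/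
def coneMap {E' F' : HermCplx X} {f : E.cplx ⟶ F.cplx} {f' : E'.cplx ⟶ F'.cplx}
    (a : E.cplx ⟶ E'.cplx) (b : F.cplx ⟶ F'.cplx) (h : f ≫ b = a ≫ f') :
    (cone f).cplx ⟶ (cone f').cplx where
  f n := coneFst f n ≫ a.f (n + 1) ≫ coneInl f' n + coneSnd f n ≫ b.f n ≫ (coneInr f').f n
  comm' m n hmn := by
    obtain rfl : m + 1 = n := hmn
    have h' : f.f (m + 1) ≫ b.f (m + 1) = a.f (m + 1) ≫ f'.f (m + 1) := by
      rw [← HomologicalComplex.comp_f, h, HomologicalComplex.comp_f]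
    refine (cone_decomp f' (m + 1)).ext_to ?_ ?_
    · simp [cone_d_fst, cone_d_fst_assoc]
    · simp [cone_d_snd, cone_d_snd_assoc, h']

section

variable {E' F' : HermCplx X} {f} {f' : E'.cplx ⟶ F'.cplx}
  (a : E.cplx ⟶ E'.cplx) (b : F.cplx ⟶ F'.cplx) (h : f ≫ b = a ≫ f')

@[simp]
lemma coneMap_fst (n : ℤ) : (coneMap a b h).f n ≫ coneFst f' n = coneFst f n ≫ a.f (n + 1) := by
  simp [coneMap]

@[simp]
lemma coneMap_fst_assoc (n : ℤ) {D : X.Modules} (g : E'.cplx.X (n + 1) ⟶ D) :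
    (coneMap a b h).f n ≫ coneFst f' n ≫ g = coneFst f n ≫ a.f (n + 1) ≫ g := by
  rw [← Category.assoc, coneMap_fst, Category.assoc]

@[simp]
lemma coneMap_snd (n : ℤ) : (coneMap a b h).f n ≫ coneSnd f' n = coneSnd f n ≫ b.f n := by
  simp [coneMap]

@[simp]
lemma coneMap_snd_assoc (n : ℤ) {D : X.Modules} (g : F'.cplx.X n ⟶ D) :
    (coneMap a b h).f n ≫ coneSnd f' n ≫ g = coneSnd f n ≫ b.f n ≫ g := by
  rw [← Category.assoc, coneMap_snd, Category.assoc]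

end

end Cone

/-- The cones of a morphism of degreewise orthogonally split extensions form such an extension. -/
lemma isExt_coneMap {A E C A' E' C' : HermCplx X} {i : A.cplx ⟶ E.cplx} {p : E.cplx ⟶ C.cplx}
    {i' : A'.cplx ⟶ E'.cplx} {p' : E'.cplx ⟶ C'.cplx} (h : IsExt i p) (h' : IsExt i' p')
    {α : A.cplx ⟶ A'.cplx} {ε : E.cplx ⟶ E'.cplx} {γ : C.cplx ⟶ C'.cplx}
    (h₁ : α ≫ i' = i ≫ ε) (h₂ : ε ≫ p' = p ≫ γ) :
    IsExt (coneMap i i' h₁) (coneMap p p' h₂) := by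
  obtain ⟨r, s, h⟩ := h.exists_decomp
  obtain ⟨r', s', h'⟩ := h'.exists_decomp
  -- The splittings are the sums of the given ones in the two cone coordinates; no compatibility
  -- with differentials is required of them.
  refine .of_decomp
    (r := fun n => coneFst ε n ≫ r (n + 1) ≫ coneInl α n +
      coneSnd ε n ≫ r' n ≫ (coneInr α).f n)
    (s := fun n => coneFst γ n ≫ s (n + 1) ≫ coneInl ε n +
      coneSnd γ n ≫ s' n ≫ (coneInr ε).f n) fun n => ⟨?_, ?_, ?_, ?_⟩
  · refine (cone_decomp α n).ext_to ?_ ?_ <;> simp [(h _).i_r, (h' _).i_r]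
  · refine (cone_decomp γ n).ext_to ?_ ?_ <;> simp [(h _).s_p, (h' _).s_p]
  · refine (cone_decomp ε n).ext_to ?_ ?_
    · simpa using congrArg (coneFst ε n ≫ ·) (h (n + 1)).total
    · simpa using congrArg (coneSnd ε n ≫ ·) (h' n).total
  · intro x u v
    rw [(cone_decomp ε n).inner, (cone_decomp α n).inner, (cone_decomp γ n).inner,
      (h _).inner, (h' _).inner]
    simp only [← fiberMap_comp, coneMap_fst, coneMap_snd, Preadditive.add_comp, Category.assoc,
      coneInl_fst, coneInl_snd, coneInr_fst, coneInr_snd, comp_zero, Category.comp_id, add_zero,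
      zero_add]
    ring

lemma ext_cone_of_isExt {A E C A' E' C' : HermCplx X} {i : A.cplx ⟶ E.cplx}
    {p : E.cplx ⟶ C.cplx} {i' : A'.cplx ⟶ E'.cplx} {p' : E'.cplx ⟶ C'.cplx} (h : IsExt i p)
    (h' : IsExt i' p') {α : A.cplx ⟶ A'.cplx} {ε : E.cplx ⟶ E'.cplx} {γ : C.cplx ⟶ C'.cplx}
    (h₁ : α ≫ i' = i ≫ ε) (h₂ : ε ≫ p' = p ≫ γ) : Ext (cone α) (cone ε) (cone γ) :=
  ⟨_, _, isExt_coneMap h h' h₁ h₂⟩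

/-- The cone of the inclusion of an extension is an extension of the quotient by a cone of an
identity. -/
lemma IsExt.ext_cone_incl {A E C : HermCplx X} {i : A.cplx ⟶ E.cplx} {p : E.cplx ⟶ C.cplx}
    (h : IsExt i p) : Ext (cone (𝟙 A.cplx)) (cone i) C := by
  -- Map the extension A = A → 0 to A → E → C by the columns identity, `i` and 0; the last cone is
  -- `C`.
  have h₀ := isExt_self_right A (isZeroCplx_zero (X := X))
  have h₁ := ext_cone_of_isExt h₀ h (α := 𝟙 _) (ε := i) (γ := 0) rfl (by rw [h.w, comp_zero])
  exact h₁.congr_right (cone_isometric_of_isZero_source _ isZeroCplx_zero).symm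

/-- If the differential of `E` vanishes, the cone of the identity of `E` is orthogonally split. -/
lemma isOrthogonallySplit_cone_id {E : HermCplx X} (hE : ∀ a b, E.cplx.d a b = 0) :
    (cone (𝟙 E.cplx)).IsOrthogonallySplit :=
  ⟨E.cplx.X, E.metric, (coneInr _).f, coneFst _, E.isVectorBundle, isExt_cone _, fun n => by
    -- Without inner differentials, the differential of the cone is (x, y) ↦ (0, x): project to `E`,
    -- then include, so Zⁿ = Eⁿ works.
    refine (cone_decomp (𝟙 E.cplx) (n + 1)).ext_to ?_ ?_
    · simp [cone_d_fst, hE]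
    · simp [cone_d_snd, hE]⟩

/-- The cone of the projection of an extension is an extension of a cone of an identity by the
shift of the sub. -/
lemma IsExt.ext_cone_proj {A E C : HermCplx X} {i : A.cplx ⟶ E.cplx} {p : E.cplx ⟶ C.cplx}
    (h : IsExt i p) : Ext A.shift (cone p) (cone (𝟙 C.cplx)) := by
  -- Map A → E → C to 0 → C = C by the columns 0, `p` and the identity; the first cone is A[1].
  have h₀ := isExt_self_left C (isZeroCplx_zero (X := X))
  have h₁ := ext_cone_of_isExt h h₀ (α := 0) (ε := p) (γ := 𝟙 _) (by rw [h.w, zero_comp]) rfl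
  exact h₁.congr_left (cone_isometric_of_isZero_target _ isZeroCplx_zero).symm

/-- A complex bounded above by `b` is an extension of a complex vanishing in degree `b`
by a complex with zero differential. -/
lemma exists_ext_top {E : HermCplx X} {b : ℤ} (hb : ∀ n, b < n → IsZero (E.cplx.X n)) :
    ∃ A C : HermCplx X, Ext A E C ∧ (∀ m n, A.cplx.d m n = 0) ∧
      (∀ n, n = b ∨ IsZero (E.cplx.X n) → IsZero (C.cplx.X n)) := by
  have key : ∀ n, ∃ (A C : X.Modules) (hA : HermitianMetric A) (hC : HermitianMetric C)
      (i : A ⟶ E.cplx.X n) (p : E.cplx.X n ⟶ C) (r : E.cplx.X n ⟶ A) (s : C ⟶ E.cplx.X n),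
      OrthDecomp hA (E.metric n) hC i p r s ∧ IsVectorBundle A ∧ IsVectorBundle C ∧
      (n ≠ b → IsZero A) ∧ (n = b ∨ IsZero (E.cplx.X n) → IsZero C) := by
    intro n
    have h := (ext_self_right (E := E) (isZeroCplx_zero (X := X)))
    obtain ⟨i, p, h⟩ := h
    obtain ⟨r, s, h⟩ := h.exists_decomp
    -- The sub is all of `E` in degree `b` and zero in every other degree.
    by_cases hn : n = b
    · exact ⟨_, _, _, _, _, _, _, _, h n, E.isVectorBundle n, (zero X).isVectorBundle n,
        fun h' => absurd hn h', fun _ => isZeroCplx_zero n⟩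
    · exact ⟨_, _, _, _, _, _, _, _, (h n).swap, (zero X).isVectorBundle n, E.isVectorBundle n,
        fun _ => isZeroCplx_zero n, fun h' => h'.resolve_left hn⟩
  choose A C hA hC i p r s h vA vC zA zC using key
  -- The differential leaving degree `b` lands in a zero term, so the top term is a subcomplex.
  have hd : ∀ m n, i m ≫ E.cplx.d m n = 0 := by
    intro m n
    by_cases hmn : m + 1 = n
    · by_cases hm : m = b
      · exact (hb n (by omega)).eq_of_tgt _ _
      · exact (zA m hm).eq_of_src _ _
    · rw [E.cplx.shape _ _ hmn, comp_zero]
  have hd' : ∀ m n, i m ≫ E.cplx.d m n ≫ p n = 0 := fun m n => by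
    rw [reassoc_of% hd m n, zero_comp]
  refine ⟨sub vA h hd', quot vC h hd', ⟨_, _, isExt_sub_quot vA vC h hd'⟩, fun m n => ?_, zC⟩
  change i m ≫ E.cplx.d m n ≫ r n = 0
  rw [reassoc_of% hd m n, zero_comp]

/-! ### Orthogonal direct sums -/

/-- `E` is, compatibly with differentials and metrics, the orthogonal direct sum of `A` and `C`. -/
def IsSum (E A C : HermCplx X) : Prop :=
  ∃ (i : A.cplx ⟶ E.cplx) (p : E.cplx ⟶ C.cplx) (r : E.cplx ⟶ A.cplx) (s : C.cplx ⟶ E.cplx),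
    ∀ n, OrthDecomp (A.metric n) (E.metric n) (C.metric n) (i.f n) (p.f n) (r.f n) (s.f n)

lemma isSum_directSum (A C : HermCplx X) : (A.directSum C).IsSum A C :=
  ⟨biprod.inl, biprod.snd, biprod.fst, biprod.inr, fun n =>
    { i_r := congrArg (fun f : A.cplx ⟶ A.cplx => f.f n) biprod.inl_fst
      s_p := congrArg (fun f : C.cplx ⟶ C.cplx => f.f n) biprod.inr_snd
      total := congrArg (fun f : A.cplx ⊞ C.cplx ⟶ A.cplx ⊞ C.cplx => f.f n) biprod.total
      inner := fun _ _ _ => rfl }⟩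

lemma IsSum.isometric {E E' A C : HermCplx X} (h : E.IsSum A C) (h' : E'.IsSum A C) :
    E.Isometric E' := by
  obtain ⟨i, p, r, s, h⟩ := h
  obtain ⟨i', p', r', s', h'⟩ := h'
  have e₁ : ∀ n, (r ≫ i' + p ≫ s').f n ≫ r'.f n = r.f n := fun n => by
    simp [(h' n).i_r, (h' n).s_r]
  have e₂ : ∀ n, (r ≫ i' + p ≫ s').f n ≫ p'.f n = p.f n := fun n => by
    simp [(h' n).i_p, (h' n).s_p]
  have e₃ : ∀ n, (r' ≫ i + p' ≫ s).f n ≫ r.f n = r'.f n := fun n => by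
    simp [(h n).i_r, (h n).s_r]
  have e₄ : ∀ n, (r' ≫ i + p' ≫ s).f n ≫ p.f n = p'.f n := fun n => by
    simp [(h n).i_p, (h n).s_p]
  refine isometric_iff.2 ⟨⟨r ≫ i' + p ≫ s', r' ≫ i + p' ≫ s, ?_, ?_⟩, fun n x u v => ?_⟩
  · ext n : 1
    exact (h n).ext_to (by simp only [HomologicalComplex.comp_f, Category.assoc, e₁, e₃,
      HomologicalComplex.id_f, Category.id_comp]) (by simp only [HomologicalComplex.comp_f,
      Category.assoc, e₂, e₄, HomologicalComplex.id_f, Category.id_comp])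
  · ext n : 1
    exact (h' n).ext_to (by simp only [HomologicalComplex.comp_f, Category.assoc, e₁, e₃,
      HomologicalComplex.id_f, Category.id_comp]) (by simp only [HomologicalComplex.comp_f,
      Category.assoc, e₂, e₄, HomologicalComplex.id_f, Category.id_comp])
  · rw [(h n).inner, (h' n).inner]
    simp only [← fiberMap_comp, e₁, e₂]

lemma IsSum.congr {E A C : HermCplx X} (h : E.IsSum A C) {E' C' : HermCplx X}
    (hE : E.Isometric E') (hC : C.Isometric C') : E'.IsSum A C' := by
  obtain ⟨i, p, r, s, h⟩ := h
  obtain ⟨e, he⟩ := isometric_iff.1 hE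
  obtain ⟨e', he'⟩ := isometric_iff.1 hC
  exact ⟨i ≫ e.hom, (e.inv ≫ p) ≫ e'.hom, e.inv ≫ r, e'.inv ≫ s ≫ e.hom, fun n =>
    ((h n).conj (hom_f_inv_f e n) (inv_f_hom_f e n) (he n)).postcomp
      (hom_f_inv_f e' n) (inv_f_hom_f e' n) (he' n)⟩

/-! ### Shifts -/

/-- The shift `E[a]` by an arbitrary integer. -/
def shiftBy (E : HermCplx X) (a : ℤ) : HermCplx X where
  cplx := (CategoryTheory.shiftFunctor (CochainComplex X.Modules ℤ) a).obj E.cplx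
  isVectorBundle n := E.isVectorBundle (n + a)
  bounded := by
    obtain ⟨l, u, h⟩ := E.bounded
    exact ⟨l - a, u - a, fun n hn => h (n + a) (by omega)⟩
  metric n := E.metric (n + a)

lemma Ext.shiftBy {A E C : HermCplx X} (h : Ext A E C) (a : ℤ) :
    Ext (A.shiftBy a) (E.shiftBy a) (C.shiftBy a) := by
  obtain ⟨i, p, h⟩ := h
  exact ⟨i⟦a⟧', p⟦a⟧', fun n => h (n + a)⟩

lemma Ext.shift {A E C : HermCplx X} (h : Ext A E C) : Ext A.shift E.shift C.shift := h.shiftBy 1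

lemma IsSum.shiftBy {E A C : HermCplx X} (h : E.IsSum A C) (a : ℤ) :
    (E.shiftBy a).IsSum (A.shiftBy a) (C.shiftBy a) := by
  obtain ⟨i, p, r, s, h⟩ := h
  exact ⟨i⟦a⟧', p⟦a⟧', r⟦a⟧', s⟦a⟧', fun n => h (n + a)⟩

lemma Isometric.shiftBy {E F : HermCplx X} (h : E.Isometric F) (a : ℤ) :
    (E.shiftBy a).Isometric (F.shiftBy a) := by
  obtain ⟨e, he⟩ := isometric_iff.1 h
  exact isometric_iff.2
    ⟨(CategoryTheory.shiftFunctor _ a).mapIso e, fun n => he (n + a)⟩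

lemma IsZeroCplx.shiftBy {E : HermCplx X} (h : E.IsZeroCplx) (a : ℤ) :
    (E.shiftBy a).IsZeroCplx := fun n => h (n + a)

/-- The canonical isomorphisms between iterated shifts are transports along equalities of degrees,
so this makes them isometries. -/
lemma preserves_XIsoOfEq (E : HermCplx X) {m n : ℤ} (h : m = n) :
    (E.metric m).Preserves (E.metric n) (E.cplx.XIsoOfEq h).hom := by
  subst h
  exact .id _

lemma shiftBy_shiftBy (E : HermCplx X) {a b c : ℤ} (h : a + b = c) :
    (E.shiftBy c).Isometric ((E.shiftBy a).shiftBy b) :=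
  isometric_iff.2 ⟨(CochainComplex.shiftFunctorAdd' X.Modules a b c h).app E.cplx, fun n =>
    E.preserves_XIsoOfEq (by omega)⟩

lemma shiftBy_zero (E : HermCplx X) : (E.shiftBy 0).Isometric E :=
  isometric_iff.2 ⟨(CochainComplex.shiftFunctorZero' X.Modules 0 rfl).app E.cplx, fun n =>
    E.preserves_XIsoOfEq (by omega)⟩

lemma shift_desuspension (E : HermCplx X) : (E.shiftBy (-1)).shift.Isometric E :=
  (E.shiftBy_shiftBy (show (-1 : ℤ) + 1 = 0 by norm_num)).symm.trans E.shiftBy_zero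

lemma desuspension_shift (E : HermCplx X) : (E.shift.shiftBy (-1)).Isometric E :=
  (E.shiftBy_shiftBy (show (1 : ℤ) + (-1) = 0 by norm_num)).symm.trans E.shiftBy_zero

lemma shiftBy_shift_comm (E : HermCplx X) (a : ℤ) :
    (E.shift.shiftBy a).Isometric (E.shiftBy a).shift :=
  (E.shiftBy_shiftBy (add_comm 1 a)).symm.trans (E.shiftBy_shiftBy rfl)

lemma IsAcyclic.shiftBy {E : HermCplx X} (h : E.IsAcyclic) (a : ℤ) : (E.shiftBy a).IsAcyclic := by
  intro n
  refine (HomologicalComplex.exactAt_iff_isZero_homology _ _).2 ?_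
  exact ((HomologicalComplex.exactAt_iff_isZero_homology _ _).1 (h (a + n))).of_iso
    ((CochainComplex.ShiftSequence.shiftIso X.Modules a n (a + n) rfl).app E.cplx)

lemma _root_.HermitianComplexes.OrthDecomp.units_smul {A B C : X.Modules} {hA : HermitianMetric A}
    {hB : HermitianMetric B} {hC : HermitianMetric C} {i : A ⟶ B} {p : B ⟶ C} {r : B ⟶ A}
    {s : C ⟶ B} (h : OrthDecomp hA hB hC i p r s) (ε : ℤˣ) :
    OrthDecomp hA hB hC i (ε • p) r (ε • s) where
  i_r := h.i_r
  s_p := by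
    rw [Linear.units_smul_comp, Linear.comp_units_smul, smul_smul, h.s_p, Int.units_mul_self,
      one_smul]
  total := by
    rw [Linear.units_smul_comp, Linear.comp_units_smul, smul_smul, Int.units_mul_self, one_smul,
      h.total]
  inner x u v := by rw [hC.inner_units_smul, h.inner]

lemma IsOrthogonallySplit.shiftBy {E : HermCplx X} (h : E.IsOrthogonallySplit) (a : ℤ) :
    (E.shiftBy a).IsOrthogonallySplit := by
  obtain ⟨Z, m, i, p, v, h, hd⟩ := h
  -- The degrees `n + a + 1` and `n + 1 + a` are equal but not definitionally so; allowing any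
  -- target degree `l` avoids transports.
  have key : ∀ k l : ℤ, k + 1 = l → ∃ p' : E.cplx.X k ⟶ Z l,
      IsOrthogonallySplitSES (m k) (E.metric k) (m l) (i k) p' ∧ E.cplx.d k l = p' ≫ i l := by
    rintro k _ rfl
    exact ⟨p k, h k, hd k⟩
  choose p' h' hd' using fun n : ℤ => key (n + a) (n + 1 + a) (by omega)
  refine ⟨fun n => Z (n + a), fun n => m (n + a), fun n => i (n + a),
    -- The sign of the shifted differential is put on the projection, and compensated in its section
    -- by `units_smul`.
    fun n => a.negOnePow • p' n, fun n => v (n + a), fun n => ?_, fun n => ?_⟩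
  · obtain ⟨r, s, H⟩ := isOrthogonallySplitSES_iff.1 (h' n)
    exact isOrthogonallySplitSES_iff.2 ⟨r, _, H.units_smul _⟩
  · refine (CochainComplex.shiftFunctor_obj_d' E.cplx a n (n + 1)).trans ?_
    exact (congrArg (fun f => a.negOnePow • f) (hd' n)).trans
      (Linear.units_smul_comp _ _ _).symm

end HermCplx

/-! ### Stability properties of ℳ₀ -/

open HermCplx

variable {X : Scheme.{0}} [X.Over SpecC]

lemma classM0_of_isSum {E F : HermCplx X} (hF : F.IsAcyclic) (h : E.IsSum F F.shift) :
    E ∈ classM0 X := Or.inr ⟨F, hF, h.isometric (isSum_directSum F F.shift)⟩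

lemma classM0_shiftBy {E : HermCplx X} (h : E ∈ classM0 X) (a : ℤ) :
    E.shiftBy a ∈ classM0 X := by
  rcases h with h | ⟨F, hF, h⟩
  · exact Or.inl (h.shiftBy a)
  · exact classM0_of_isSum (hF.shiftBy a)
      (((isSum_directSum F F.shift).shiftBy a).congr (h.symm.shiftBy a) (F.shiftBy_shift_comm a))

lemma classM0_of_isZeroCplx {E : HermCplx X} (h : E.IsZeroCplx) : E ∈ classM0 X :=
  Or.inl ⟨E.cplx.X, E.metric, fun _ => 𝟙 _, fun _ => 0, E.isVectorBundle, fun n =>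
    isOrthogonallySplitSES_iff.2 ⟨𝟙 _, 0, by simp, (h _).eq_of_src _ _, by simp, fun x u v => by
      rw [fiberMap_id, fiberMap_id, fiber_eq_zero (h n) x u, fiberMap_zero,
        HermitianMetric.inner_zero_left, HermitianMetric.inner_zero_left, add_zero]⟩,
    fun n => (h n).eq_of_src _ _⟩

/-! ### Iterated extensions of complexes of `ℳ₀` -/

/-- The complexes obtained from zero by finitely many degreewise orthogonally split extensions
by complexes of `ℳ₀`. -/
inductive IsFiltered : HermCplx X → Prop
  | zero {E : HermCplx X} (h : E.IsZeroCplx) : IsFiltered E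
  | ext {A E K : HermCplx X} (hA : IsFiltered A) (hK : K ∈ classM0 X) (h : Ext A E K) :
    IsFiltered E

namespace IsFiltered

lemma of_mem_classM0 {E : HermCplx X} (h : E ∈ classM0 X) : IsFiltered E :=
  .ext (.zero isZeroCplx_zero) h (ext_self_left isZeroCplx_zero)

lemma of_isometric {E E' : HermCplx X} (h : IsFiltered E) (e : E.Isometric E') :
    IsFiltered E' := by
  cases h with
  | zero h =>
    obtain ⟨e, -⟩ := e
    exact .zero (isZeroCplx_of_isZero (h.isZero.of_iso e.symm))
  | ext hA hK h => exact .ext hA hK (h.congr_middle e)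

/-- Pull the filtration of `C` back to `E`: the preimage of each step is an extension of that step
by `A`, and the graded pieces are unchanged. -/
lemma of_ext {A E C : HermCplx X} (hA : IsFiltered A) (hC : IsFiltered C) (h : Ext A E C) :
    IsFiltered E := by
  induction hC generalizing E with
  | zero hC => exact hA.of_isometric (h.isometric_left hC)
  | ext _ hK h' ih =>
    obtain ⟨E', h₁, h₂⟩ := h.preimage h'
    exact .ext (ih h₁) hK h₂

lemma shiftBy {E : HermCplx X} (h : IsFiltered E) (a : ℤ) : IsFiltered (E.shiftBy a) := by
  induction h with
  | zero h => exact .zero (h.shiftBy a)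
  | ext _ hK h ih => exact .ext ih (classM0_shiftBy hK a) (h.shiftBy a)

lemma shift {E : HermCplx X} (h : IsFiltered E) : IsFiltered E.shift := h.shiftBy 1

lemma cone_of_isZero {E F : HermCplx X} (f : E.cplx ⟶ F.cplx) (hE : E.IsZeroCplx)
    (hF : F.IsZeroCplx) : IsFiltered (cone f) :=
  .of_isometric (.zero hF) (cone_isometric_of_isZero_source f hE)

/-- Peel off the top degree and induct on the length. The cone of the identity is compatible with
extensions, and for a complex with zero differential it is orthogonally split. -/
lemma cone_id (E : HermCplx X) : IsFiltered (cone (𝟙 E.cplx)) := by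
  obtain ⟨a, b, h⟩ := E.bounded
  -- The strict bound makes `k = 0` mean `b < a`, so that all terms vanish in the base case.
  obtain ⟨k, hk⟩ : ∃ k : ℕ, b - a < k := ⟨(b - a + 1).toNat, by omega⟩
  induction k generalizing E b with
  | zero => exact cone_of_isZero _ (fun n => h n (by omega)) (fun n => h n (by omega))
  | succ k ih =>
    obtain ⟨A, C, ⟨i, p, hE⟩, hA, hC⟩ := exists_ext_top fun n hn => h n (Or.inr hn)
    have h₁ : IsFiltered (cone (𝟙 C.cplx)) := by
      refine ih C (b - 1) (fun n hn => hC n ?_) (by omega)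
      by_cases hnb : n = b
      · exact Or.inl hnb
      · exact Or.inr (h n (by omega))
    exact of_ext (of_mem_classM0 (Or.inl (isOrthogonallySplit_cone_id hA))) h₁
      (ext_cone_of_isExt hE hE (ε := 𝟙 _) (by simp) (by simp))

end IsFiltered

/-! ### Comparison with filtrations -/

/-- Each step is a degreewise retract of the previous one, so a filtration that reaches zero stays
zero. -/
lemma HermCplx.OrthogonalFiltration.isZeroCplx_of_le {E : HermCplx X}
    (Φ : E.OrthogonalFiltration) {b p : ℤ} (hb : (Φ.Fil b).IsZeroCplx) (h : b ≤ p) :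
    (Φ.Fil p).IsZeroCplx := by
  induction p, h using Int.leInduction with
  | base => exact hb
  | succ p _ ih =>
    intro n
    obtain ⟨r, s, h⟩ := isOrthogonallySplitSES_iff.1 (Φ.split p n)
    rw [IsZero.iff_id_eq_zero, ← h.i_r, (ih n).eq_of_tgt ((Φ.incl p).f n) 0, zero_comp]

lemma IsFiltered.of_mem_classMF {E : HermCplx X} (h : E ∈ classMF X) : IsFiltered E := by
  obtain ⟨Φ, hΦ⟩ := h
  obtain ⟨a, ha⟩ := Φ.exists_top
  obtain ⟨b, hb⟩ := Φ.exists_bot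
  have h₁ : ∀ p, p ≤ b → IsFiltered (Φ.Fil p) := by
    intro p hp
    induction p, hp using Int.leInductionDown with
    | base => exact .zero (isZeroCplx_of_isZero hb)
    | pred p _ ih =>
      have := Φ.split (p - 1)
      refine .ext (A := Φ.Fil (p - 1 + 1)) ?_ (hΦ (p - 1)) ⟨_, _, this⟩
      rwa [sub_add_cancel]
  -- Nothing forces `a ≤ b`; in the opposite case `Fil a`, hence `E`, is zero.
  have h₂ : IsFiltered (Φ.Fil a) := by
    rcases le_total a b with h | h
    · exact h₁ a h
    · exact .zero (Φ.isZeroCplx_of_le (isZeroCplx_of_isZero hb) h)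
  exact h₂.of_isometric (isometric_iff.2 ⟨asIso (Φ.emb a), fun n => Φ.inner_emb a n⟩)

lemma HermCplx.IsExt.mono {A E C : HermCplx X} {i : A.cplx ⟶ E.cplx} {p : E.cplx ⟶ C.cplx}
    (h : IsExt i p) : Mono i := by
  obtain ⟨r, s, h⟩ := h.exists_decomp
  have : ∀ n, Mono (i.f n) := fun n => mono_of_mono_fac (h n).i_r
  exact HomologicalComplex.mono_of_mono_f i this

lemma classMF_of_ext {A E K : HermCplx X} (hA : A ∈ classMF X) (hK : K ∈ classM0 X)
    (h : Ext A E K) : E ∈ classMF X := by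
  obtain ⟨Φ, hΦ⟩ := hA
  obtain ⟨i, q, h⟩ := h
  have hi : Mono i := h.mono
  obtain ⟨r, s, H⟩ := h.exists_decomp
  obtain ⟨a, ha⟩ := Φ.exists_top
  obtain ⟨b, hb⟩ := Φ.exists_bot
  -- Keep the filtration of `A` from index `a` on, where `Fil a` is all of `A`, and put `E` below.
  -- The only new nonzero graded piece is `K`, at index `a - 1`.
  let G : ℤ → Σ F : HermCplx X, (F.cplx ⟶ E.cplx) := fun p =>
    if p < a then ⟨E, 𝟙 _⟩ else ⟨Φ.Fil p, Φ.emb p ≫ i⟩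
  have G₁ : ∀ p, p < a → G p = ⟨E, 𝟙 _⟩ := fun p hp => if_pos hp
  have G₂ : ∀ p, ¬ p < a → G p = ⟨Φ.Fil p, Φ.emb p ≫ i⟩ := fun p hp => if_neg hp
  have hmono : ∀ p, Mono (G p).2 := fun p => by
    have := Φ.mono_emb p
    by_cases hp : p < a
    · rw [G₁ p hp]
      infer_instance
    · rw [G₂ p hp]
      exact mono_comp _ _
  have hpres : ∀ p n, ((G p).1.metric n).Preserves (E.metric n) ((G p).2.f n) := fun p n => by
    by_cases hp : p < a
    · rw [G₁ p hp]
      exact .id _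
    · rw [G₂ p hp]
      exact HermitianMetric.Preserves.comp (Φ.inner_emb p n) (H n).preserves_i
  have hstep : ∀ p, ∃ (incl : (G (p + 1)).1.cplx ⟶ (G p).1.cplx) (K : HermCplx X)
      (proj : (G p).1.cplx ⟶ K.cplx), incl ≫ (G p).2 = (G (p + 1)).2 ∧ IsExt incl proj ∧
        K ∈ classM0 X := fun p => by
    by_cases hp : p < a
    · rw [G₁ p hp]
      by_cases hp' : p + 1 < a
      · rw [G₁ _ hp']
        exact ⟨𝟙 _, zero X, 0, rfl, isExt_self_right E isZeroCplx_zero,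
          classM0_of_isZeroCplx isZeroCplx_zero⟩
      · obtain rfl : p + 1 = a := by omega
        rw [G₂ _ hp']
        -- `Fil a` is only isometric to `A`, through `emb`, so the splitting is transported along
        -- it.
        exact ⟨Φ.emb (p + 1) ≫ i, K, q, Category.comp_id _, .of_decomp fun n =>
          (H n).precomp (hom_f_inv_f (asIso (Φ.emb (p + 1))) n)
            (inv_f_hom_f (asIso (Φ.emb (p + 1))) n) (Φ.inner_emb _ n), hK⟩
    · rw [G₂ p hp, G₂ (p + 1) (by omega)]
      exact ⟨Φ.incl p, Φ.Gr p, Φ.proj p, by rw [reassoc_of% (Φ.incl_emb p)], Φ.split p, hΦ p⟩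
  choose incl Gr proj h₁ h₂ h₃ using hstep
  refine ⟨{
    Fil := fun p => (G p).1
    emb := fun p => (G p).2
    mono_emb := hmono
    inner_emb := hpres
    incl := incl
    incl_emb := h₁
    exists_top := ⟨a - 1, ?_⟩
    exists_bot := ⟨max a b, ?_⟩
    Gr := Gr
    proj := proj
    split := h₂ }, h₃⟩
  · rw [G₁ _ (by omega)]
    infer_instance
  · rw [G₂ _ (by omega)]
    exact (Φ.isZeroCplx_of_le (isZeroCplx_of_isZero hb) (le_max_right a b)).isZero

lemma classMF_of_isZeroCplx {E : HermCplx X} (h : E.IsZeroCplx) : E ∈ classMF X :=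
  ⟨{  Fil := fun _ => E
      emb := fun _ => 𝟙 _
      mono_emb := fun _ => inferInstance
      inner_emb := fun _ n => HermitianMetric.Preserves.id (E.metric n)
      incl := fun _ => 𝟙 _
      incl_emb := fun _ => Category.comp_id _
      exists_top := ⟨0, inferInstance⟩
      exists_bot := ⟨0, h.isZero⟩
      Gr := fun _ => E
      proj := fun _ => 0
      split := fun _ => isExt_self_right E h }, fun _ => classM0_of_isZeroCplx h⟩

lemma mem_classMF_iff {E : HermCplx X} : E ∈ classMF X ↔ IsFiltered E := by
  refine ⟨.of_mem_classMF, fun h => ?_⟩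
  induction h with
  | zero h => exact classMF_of_isZeroCplx h
  | ext _ hK h ih => exact classMF_of_ext ih hK h

/-! ### Complexes that become filtered after an extension by a filtered complex -/

/-- `E` is the kernel of a degreewise orthogonally split epimorphism of filtered complexes. -/
def IsStablyFiltered (E : HermCplx X) : Prop := ∃ A B, IsFiltered A ∧ IsFiltered B ∧ Ext E A B

namespace IsStablyFiltered

lemma of_isFiltered {E : HermCplx X} (h : IsFiltered E) : IsStablyFiltered E :=
  ⟨E, zero X, h, .zero isZeroCplx_zero, ext_self_right isZeroCplx_zero⟩

lemma of_isometric {E E' : HermCplx X} (h : IsStablyFiltered E) (e : E.Isometric E') :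
    IsStablyFiltered E' := by
  obtain ⟨A, B, hA, hB, h⟩ := h
  exact ⟨A, B, hA, hB, h.congr_left e.symm⟩

lemma shiftBy {E : HermCplx X} (h : IsStablyFiltered E) (a : ℤ) :
    IsStablyFiltered (E.shiftBy a) := by
  obtain ⟨A, B, hA, hB, h⟩ := h
  exact ⟨_, _, hA.shiftBy a, hB.shiftBy a, h.shiftBy a⟩

lemma shift {E : HermCplx X} (h : IsStablyFiltered E) : IsStablyFiltered E.shift := h.shiftBy 1

lemma of_shift {E : HermCplx X} (h : IsStablyFiltered E.shift) : IsStablyFiltered E :=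
  (h.shiftBy (-1)).of_isometric E.desuspension_shift

/-- For p : B → E, the complex `E` is the kernel of cone(p) → B[1], and cone(p) is filtered, being
an extension of the cone of an identity by A[1]. -/
lemma of_quotient {A B E : HermCplx X} (hA : IsFiltered A) (hB : IsFiltered B) (h : Ext A B E) :
    IsStablyFiltered E := by
  obtain ⟨i, p, h⟩ := h
  exact ⟨_, _, .of_ext hA.shift (.cone_id E) h.ext_cone_proj, hB.shift, ext_cone p⟩

/-- Embed E[-1] by `i` in a filtered `A` with filtered quotient. Then cone(i) is filtered, and its
quotient by `A` is E[-1][1], that is `E`. -/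
lemma exists_quotient {E : HermCplx X} (h : IsStablyFiltered E) :
    ∃ A B, IsFiltered A ∧ IsFiltered B ∧ Ext A B E := by
  obtain ⟨A, B, hA, hB, h⟩ := h.shiftBy (-1)
  obtain ⟨i, p, h⟩ := h
  exact ⟨_, _, hA, .of_ext (.cone_id _) hB h.ext_cone_incl,
    (ext_cone i).congr_right E.shift_desuspension⟩

/-- If E ⊆ F with filtered quotient `B`, then F/A is an extension of `B` by `C`, hence filtered. -/
lemma sub_of_ext {A E C : HermCplx X} (h : Ext A E C) (hE : IsStablyFiltered E)
    (hC : IsFiltered C) : IsStablyFiltered A := by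
  obtain ⟨F, B, hF, hB, h'⟩ := hE
  obtain ⟨Q, h₁, h₂⟩ := h'.quotient h
  exact ⟨F, Q, hF, hC.of_ext hB h₂, h₁⟩

/-- Dual argument: write `E` as B/F; the preimage of `A` in `B` is an extension of `A` by `F`, and
`C` is the quotient of `B` by it. -/
lemma quotient_of_ext {A E C : HermCplx X} (h : Ext A E C) (hE : IsStablyFiltered E)
    (hA : IsFiltered A) : IsStablyFiltered C := by
  obtain ⟨F, B, hF, hB, h'⟩ := hE.exists_quotient
  obtain ⟨Q, h₁, h₂⟩ := h'.preimage h
  exact of_quotient (hF.of_ext hA h₁) hB h₂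

/-- Writing `E` as B/A presents cone(f) as the quotient of the cone of B → E → F, an extension of
B[1] by `F`, by A[1]. -/
lemma cone_of_isFiltered {E F : HermCplx X} (f : E.cplx ⟶ F.cplx) (hE : IsStablyFiltered E)
    (hF : IsFiltered F) : IsStablyFiltered (cone f) := by
  obtain ⟨A, B, hA, hB, i, p, h⟩ := hE.exists_quotient
  have h' := ext_cone_of_isExt h (isExt_self_left F isZeroCplx_zero) (α := 0) (ε := p ≫ f)
    (γ := f) (by rw [reassoc_of% h.w, zero_comp, zero_comp]) (Category.comp_id _)
  refine of_quotient (.of_isometric hA.shift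
    (cone_isometric_of_isZero_target _ isZeroCplx_zero).symm) ?_ h'
  exact hF.of_ext hB.shift (ext_cone (p ≫ f))

/-- Embedding `F` in a filtered `A` with quotient `B` makes cone(f) the kernel of a split
epimorphism from the cone of E → A to `B`, which reduces to a filtered target. -/
lemma cone {E F : HermCplx X} (f : E.cplx ⟶ F.cplx) (hE : IsStablyFiltered E)
    (hF : IsStablyFiltered F) : IsStablyFiltered (cone f) := by
  obtain ⟨A, B, hA, hB, i, p, h⟩ := hF
  have h' := ext_cone_of_isExt (isExt_self_right E isZeroCplx_zero) h (α := f) (ε := f ≫ i)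
    (γ := 0) (Category.id_comp _).symm (by rw [Category.assoc, h.w, comp_zero, zero_comp])
  exact sub_of_ext h' (cone_of_isFiltered _ hE hA)
    (hB.of_isometric (cone_isometric_of_isZero_source _ isZeroCplx_zero))

end IsStablyFiltered

-- Rotation: up to the cone of an identity, the cone of cone(f) → E[1] is F[1] and the cone of F →
-- cone(f) is E[1]. Cones of identities are filtered, so both cases reduce to stability under cones.
variable (X) in
lemma twoOutOfThree_isStablyFiltered : TwoOutOfThree X {E | IsStablyFiltered E} := by
  refine fun E F f => ⟨.cone f, fun hE hf => ?_, fun hF hf => ?_⟩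
  · exact (IsStablyFiltered.sub_of_ext (isExt_cone f).ext_cone_proj
      (.cone (coneProj f) hf hE.shift) (.cone_id _)).of_shift
  · exact (IsStablyFiltered.quotient_of_ext (isExt_cone f).ext_cone_incl
      (.cone (coneInr f) hF hf) (.cone_id _)).of_shift

lemma mem_classMS_iff {E : HermCplx X} : E ∈ classMS X ↔ IsStablyFiltered E := by
  constructor
  · rintro ⟨F, f, hF, hf⟩
    rw [mem_classMF_iff] at hF hf
    exact (twoOutOfThree_isStablyFiltered X E F f).2.2 (.of_isFiltered hF) (.of_isFiltered hf)
  · rintro ⟨A, B, hA, hB, i, p, h⟩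
    exact ⟨A, i, mem_classMF_iff.2 hA, mem_classMF_iff.2 (.of_ext (.cone_id E) hB h.ext_cone_incl)⟩

lemma meager_subset_classMS : meager X ⊆ classMS X := by
  intro E hE
  refine mem_classMS_iff.2 (hE _ (fun K hK => ?_) (twoOutOfThree_isStablyFiltered X))
  exact .of_isFiltered (.of_mem_classM0 hK)

/-! ### Classes with the two-out-of-three property -/

lemma HermCplx.Ext.isAcyclic {A E C : HermCplx X} (h : Ext A E C) (hA : A.IsAcyclic)
    (hC : C.IsAcyclic) : E.IsAcyclic := by
  obtain ⟨i, p, h⟩ := h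
  have w := h.w
  obtain ⟨r, s, H⟩ := h.exists_decomp
  let S : ShortComplex (CochainComplex X.Modules ℤ) := ShortComplex.mk i p w
  have hS : S.ShortExact := HomologicalComplex.shortExact_of_degreewise_shortExact S fun n =>
    ShortComplex.Splitting.shortExact
      { r := r n
        s := s n
        f_r := (H n).i_r
        s_g := (H n).s_p
        id := (H n).total }
  exact hS.acyclic_X₂ hA hC

lemma HermCplx.IsOrthogonallySplit.isAcyclic {E : HermCplx X} (h : E.IsOrthogonallySplit) :
    E.IsAcyclic := by
  obtain ⟨Z, m, i, p, -, h, hd⟩ := h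
  choose r s H using fun n => isOrthogonallySplitSES_iff.1 (h n)
  intro n
  obtain ⟨k, rfl⟩ : ∃ k, n = k + 1 := ⟨n - 1, by omega⟩
  have key : ∀ (A : X.Modules) (x : A ⟶ E.cplx.X (k + 1)),
      x ≫ E.cplx.d (k + 1) (k + 1 + 1) = 0 → ∃ y : A ⟶ E.cplx.X k, x = y ≫ E.cplx.d k (k + 1) := by
    intro A x hx
    have hp : x ≫ p (k + 1) = 0 := by
      have h₁ : (x ≫ p (k + 1) ≫ i (k + 1 + 1)) ≫ r (k + 1 + 1) = 0 := by
        rw [← hd, hx, zero_comp]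
      simpa [(H (k + 1 + 1)).i_r] using h₁
    -- A cycle is killed by `p`, so it comes from `Z (k + 1)` through `r`; the section `s k` then
    -- lifts it to degree `k`.
    refine ⟨x ≫ r (k + 1) ≫ s k, ?_⟩
    rw [hd, Category.assoc, Category.assoc, (H k).s_p_assoc]
    simpa [reassoc_of% hp] using (congrArg (fun f => x ≫ f) (H (k + 1)).total).symm
  rw [E.cplx.exactAt_iff' k (k + 1) (k + 1 + 1) (by simp) (by simp),
    ShortComplex.exact_iff_exact_up_to_refinements]
  intro A x hx
  obtain ⟨y, hy⟩ := key A x hx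
  exact ⟨A, 𝟙 A, inferInstance, y, (Category.id_comp _).trans hy⟩

lemma HermCplx.IsSum.ext {E A C : HermCplx X} (h : E.IsSum A C) : Ext A E C := by
  obtain ⟨i, p, r, s, h⟩ := h
  exact ⟨i, p, .of_decomp h⟩

lemma isAcyclic_of_mem_classM0 {E : HermCplx X} (h : E ∈ classM0 X) : E.IsAcyclic := by
  rcases h with h | ⟨F, hF, e⟩
  · exact h.isAcyclic
  · exact ((isSum_directSum F F.shift).ext.congr_middle e.symm).isAcyclic hF (hF.shiftBy 1)

lemma IsFiltered.isAcyclic {E : HermCplx X} (h : IsFiltered E) : E.IsAcyclic := by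
  induction h with
  | zero h => exact isAcyclic_of_mem_classM0 (classM0_of_isZeroCplx h)
  | ext _ hK h ih => exact h.isAcyclic ih (isAcyclic_of_mem_classM0 hK)

lemma HermCplx.isSum_cone_zero (E F : HermCplx X) :
    (HermCplx.cone (0 : E.cplx ⟶ F.cplx)).IsSum F E.shift := by
  refine ⟨coneInr _, coneProj _, ⟨coneSnd _, ?_⟩, ⟨coneInl _, ?_⟩,
    fun n => (cone_decomp _ n).swap⟩
  · intro a b hab
    obtain rfl : a + 1 = b := hab
    rw [cone_d_snd, HomologicalComplex.zero_f, comp_zero, zero_add]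
  · intro a b hab
    obtain rfl : a + 1 = b := hab
    have h : coneInl (0 : E.cplx ⟶ F.cplx) a ≫ (HermCplx.cone 0).cplx.d a (a + 1) =
        -(E.cplx.d (a + 1) (a + 1 + 1) ≫ coneInl 0 (a + 1)) :=
      (cone_decomp (0 : E.cplx ⟶ F.cplx) (a + 1)).ext_to
        (by simp [cone_d_fst]) (by simp [cone_d_snd])
    exact h.trans ((Preadditive.neg_comp _ _).symm.trans
      (congrArg (fun g => g ≫ coneInl 0 (a + 1)) (shift_d E a (a + 1)).symm))

/-- The cone of 0 : E → E' is E' ⊕ E[1], isometric to E' ⊕ E'[1]. Acyclicity of `E'` puts it in ℳ₀,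
and two-out-of-three applies. -/
lemma mem_of_isometric {C : Set (HermCplx X)} (h₀ : classM0 X ⊆ C) (hC : TwoOutOfThree X C)
    {E E' : HermCplx X} (hE : E ∈ C) (e : E.Isometric E') (hE' : E'.IsAcyclic) : E' ∈ C :=
  (hC E E' 0).2.1 hE (h₀ (classM0_of_isSum hE'
    ((isSum_cone_zero E E').congr (.refl _) (e.shiftBy 1))))

/-- Here δ is the connecting morphism measuring how far the degreewise splitting is from a chain
map. The isomorphism combines the section `s` with `-i`, and it is isometric because the splitting
is orthogonal and signs do not affect the metric. -/
lemma exists_cone_isometric_shift {A E K : HermCplx X} (h : Ext A E K) :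
    ∃ δ : K.cplx ⟶ A.shift.cplx, (HermCplx.cone δ).Isometric E.shift := by
  obtain ⟨i, p, h⟩ := h
  obtain ⟨r, s, H⟩ := h.exists_decomp
  let S : ShortComplex (CochainComplex X.Modules ℤ) := ShortComplex.mk i p h.w
  let σ : ∀ n, (S.map (HomologicalComplex.eval X.Modules (ComplexShape.up ℤ) n)).Splitting :=
    fun n =>
      { r := r n
        s := s n
        f_r := (H n).i_r
        s_g := (H n).s_p
        id := (H n).total }
  let δ : K.cplx ⟶ A.shift.cplx := CochainComplex.homOfDegreewiseSplit S σ
  refine ⟨δ, isometric_iff.2 ⟨CochainComplex.mappingConeHomOfDegreewiseSplitIso S σ,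
    fun n x u v => ?_⟩⟩
  let t : (HermCplx.cone δ).cplx.X n ⟶ A.cplx.X (n + 1) := coneSnd δ n
  let φ : (HermCplx.cone δ).cplx.X n ⟶ E.cplx.X (n + 1) :=
    coneFst δ n ≫ s (n + 1) - t ≫ i.f (n + 1)
  have hφ : (CochainComplex.mappingConeHomOfDegreewiseSplitIso S σ).hom.f n = φ := by
    refine (CochainComplex.mappingConeHomOfDegreewiseSplitIso_hom_f S σ n).trans ?_
    change _ - _ ≫ (CochainComplex.HomComplex.Cochain.ofHom i).v (n + 1) (n + 1) _ = _
    rw [CochainComplex.HomComplex.Cochain.ofHom_v]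
    rfl
  have h₁ : φ ≫ r (n + 1) = -t := by
    simp [φ, (H _).i_r, (H _).s_r]
  have h₂ : φ ≫ p.f (n + 1) = coneFst δ n := by
    simp [φ, (H _).i_p, (H _).s_p]
  rw [hφ]
  refine ((H (n + 1)).inner x _ _).trans (Eq.trans ?_ ((cone_decomp δ n).inner x u v).symm)
  have e₁ : ∀ w, fiberMap x (r (n + 1)) (fiberMap x φ w) = -fiberMap x t w := fun w => by
    rw [← fiberMap_comp, h₁, fiberMap_neg]
  have e₂ : ∀ w, fiberMap x (p.f (n + 1)) (fiberMap x φ w) = fiberMap x (coneFst δ n) w :=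
    fun w => by rw [← fiberMap_comp, h₂]
  rw [add_comm]
  exact congrArg₂ (· + ·) (congrArg₂ _ (e₂ u) (e₂ v))
    ((congrArg₂ _ (e₁ u) (e₁ v)).trans (HermitianMetric.inner_neg_neg _ x _ _))

/-- An extension `E` of `K` by `A` is recovered from the cone of K → A[1], which is E[1]. Filtered
complexes are acyclic, so membership may be moved along the isometries needed. -/
lemma IsFiltered.mem {C : Set (HermCplx X)} (h₀ : classM0 X ⊆ C) (hC : TwoOutOfThree X C)
    {E : HermCplx X} (h : IsFiltered E) : E ∈ C := by
  have hz : HermCplx.zero X ∈ C := h₀ (classM0_of_isZeroCplx isZeroCplx_zero)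
  induction h with
  | zero h => exact h₀ (classM0_of_isZeroCplx h)
  | @ext A E K hA hK h ih =>
    have aA := hA.isAcyclic
    have aE := h.isAcyclic aA (isAcyclic_of_mem_classM0 hK)
    have sA : A.shift ∈ C := mem_of_isometric h₀ hC ((hC A (HermCplx.zero X) 0).1 ih hz)
      (cone_isometric_of_isZero_target _ isZeroCplx_zero) (aA.shiftBy 1)
    obtain ⟨δ, e⟩ := exists_cone_isometric_shift h
    have hδ : cone δ ∈ C := (hC K A.shift δ).1 (h₀ hK) sA
    -- Realising E[1] as the cone of E → 0 lets two-out-of-three remove the shift.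
    have e' : (cone δ).Isometric (cone (0 : E.cplx ⟶ (HermCplx.zero X).cplx)) :=
      e.trans (cone_isometric_of_isZero_target _ isZeroCplx_zero).symm
    refine (hC E (HermCplx.zero X) 0).2.2 hz (mem_of_isometric h₀ hC hδ e' ?_)
    exact (ext_cone _).isAcyclic
      (isAcyclic_of_mem_classM0 (classM0_of_isZeroCplx isZeroCplx_zero)) (aE.shiftBy 1)

lemma classMS_subset_meager : classMS X ⊆ meager X := by
  rintro E ⟨F, f, hF, hf⟩ C h₀ hC
  exact (hC E F f).2.2 ((mem_classMF_iff.1 hF).mem h₀ hC) ((mem_classMF_iff.1 hf).mem h₀ hC)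

end HermitianComplexes

end

theorem theorem2 (X : AlgebraicGeometry.Scheme.{0}) [X.Over HermitianComplexes.SpecC]
    [AlgebraicGeometry.Smooth (X ↘ HermitianComplexes.SpecC)]
    [AlgebraicGeometry.IsSeparated (X ↘ HermitianComplexes.SpecC)]
    [AlgebraicGeometry.LocallyOfFiniteType (X ↘ HermitianComplexes.SpecC)]
    [AlgebraicGeometry.QuasiCompact (X ↘ HermitianComplexes.SpecC)] :
    HermitianComplexes.meager X = HermitianComplexes.classMS X :=
  Set.Subset.antisymm HermitianComplexes.meager_subset_classMS
    HermitianComplexes.classMS_subset_meager
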